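/- Let $d\ge 1$ and let $P\subset\mathbb R^{d-1}\subset\mathbb P(\mathbb R^d)$ be a bounded real convex polytope (the convex hull of finitely many points) with non-empty interior $\Omega$, let $x\in\Omega$, and let $(\lambda_k)_{k\in\mathbb N}$ be a scaling sequence, i.e. a sequence of real numbers with $\lambda_k\ge 1$ and $\lambda_k\to\infty$. Then the pointed metric spaces $(\Omega,\tfrac1{\lambda_k}d_\Omega,x)$ converge to $(K,o)$ in the pointed Gromov–Hausdorff topology. Here: * $d_\Omega(y,z)=\sup_{\varphi,\psi}\log\left|\frac{\psi(y)}{\psi(z)}\cdot\frac{\varphi(z)}{\varphi(y)}\right|$ is the Hilbert metric, the supremum being over all pairs of linear forms on $\mathbb R^d$ whose projective hyperplanes are disjoint from $\Omega$ (evaluated on lifts of $y,z$). * $(K,o)$ is the geometric realization of the flag complex of $P$ modeled on the Weyl chamber of type $A_{d-1}$. On $\mathbb A=\mathbb R^d/\mathbb R(1,\dots,1)$ take the metric $d_{\mathrm H}$ of the norm $\|[\alpha]\|=\max_{i,j}|\alpha_i-\alpha_j|$, let $\mathbb A^+=\{[\alpha]:\alpha_1\ge\dots\ge\alpha_d\}$,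 and for $D\subseteq\{1,\dots,d-1\}$ let $\mathbb A^+_D=\{[\alpha]\in\mathbb A^+:\alpha_i=\alpha_{i+1}\text{ for all } i\in\{1,\dots,d-1\}\setminus D\}$. Let $\mathrm{Flags}_*(P)$ be the set of flags (chains for inclusion of non-empty faces) of $P$ that contain $P$, and for such a flag $F$ put $D(F)=\{\dim\sigma+1:\sigma\in F,\ \sigma\ne P\}$. Then $K=\big(\bigsqcup_{F\in\mathrm{Flags}_*(P)}\mathbb A^+_{D(F)}\times\{F\}\big)/\!\sim$, where $\sim$ is generated by $(a,F)\sim(a,F')$ for $F\subseteq F'$. The distance of $p,q\in K$ is the infimum of $\sum_{i=0}^N d_{\mathrm H}(a_i,b_i)$ over all finite chains of pairs $(a_i,F_i),(b_i,F_i)$ of points in a common piece such that $(a_0,F_0)$ represents $p$, $(b_N,F_N)$ represents $q$, and $(b_i,F_i)\sim(a_{i+1},F_{i+1})$ for all $i<N$. The cone point $o$ is the class of $(0,F)$, for any $F$. * $(E_k,d_k,o_k)\to(E,d,o)$ in the pointed Gromov–Hausdorff sense means: for all $r\ge0$ and $\varepsilon>0$ there is, for all large $k$, a map $f$ from the closed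 ball $\overline B_r(o_k)\subset E_k$ to $E$ with $f(o_k)=o$ and $\sup_{y,z\in\overline B_r(o_k)}|d(f(y),f(z))-d_k(y,z)|<\varepsilon$, such that the $\varepsilon$-neighbourhood of $f(\overline B_r(o_k))$ contains $\overline B_{r-\varepsilon}(o)$. -/

import Mathlib

open Set Filter Topology
open scoped ENNReal

/-! ### Pointed Gromov–Hausdorff convergence -/

/-- The pointed spaces `(E k, d k, o k)` converge to `(E', d', o')` in the pointed
Gromov–Hausdorff sense: for every radius `r` and every `ε > 0`, for all large `k` there is a map
`f` from the closed ball of radius `r` around `o k` to `E'`, with `f (o k) = o'`, whose distortion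
on that ball is less than `ε` and such that the `ε`-neighbourhood of the image of the ball contains
the closed ball of radius `r - ε` around `o'`.
(Values of `f` outside the ball are irrelevant.) -/
def PointedGHConverges {E : ℕ → Type*} {E' : Type*} (d : ∀ k, E k → E k → ℝ) (o : ∀ k, E k)
    (d' : E' → E' → ℝ) (o' : E') : Prop :=
  ∀ r : ℝ, 0 ≤ r → ∀ ε : ℝ, 0 < ε → ∀ᶠ k in atTop, ∃ f : E k → E',
    f (o k) = o' ∧
    (∃ δ < ε, ∀ a b : E k, d k (o k) a ≤ r → d k (o k) b ≤ r →
      |d' (f a) (f b) - d k a b| ≤ δ) ∧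
    (∀ z : E', d' o' z ≤ r - ε → ∃ a : E k, d k (o k) a ≤ r ∧ d' z (f a) < ε)

/-! ### The Hilbert metric -/

section Hilbert

variable {E : Type*} [AddCommGroup E] [Module ℝ E]

/-- The hyperplanes of the projective completion `ℙ(E × ℝ)` of `E` that miss `Ω ⊆ E`, each given
by all its equations: a linear form on `E × ℝ` is the same as an affine function on `E` (restrict to
`E × {1}`), the nonzero constants being the equations of the hyperplane at infinity. -/
def missingHyperplanes (Ω : Set E) : Set (E →ᵃ[ℝ] ℝ) := {φ | ∀ z ∈ Ω, φ z ≠ 0}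

/-- The cross-ratio `[φ, x, y, ψ]` of two points and two hyperplanes. -/
noncomputable def crossRatio (φ : E →ᵃ[ℝ] ℝ) (x y : E) (ψ : E →ᵃ[ℝ] ℝ) : ℝ :=
  ψ x / ψ y * (φ y / φ x)

/-- The Hilbert distance of `Ω`: the supremum of `log |[φ, x, y, ψ]|` over all pairs of hyperplanes
missing `Ω`.  For `Ω` open and convex the supremum is finite, see `bddAbove_hilbertDist`. -/
noncomputable def hilbertDist (Ω : Set E) (x y : E) : ℝ :=
  ⨆ p : missingHyperplanes Ω × missingHyperplanes Ω,
    Real.log |crossRatio (p.1 : E →ᵃ[ℝ] ℝ) x y (p.2 : E →ᵃ[ℝ] ℝ)|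

theorem abs_div_le_of_missing {Ω : Set E} (hc : Convex ℝ Ω) {x y : E} (hx : x ∈ Ω) (hy : y ∈ Ω)
    {t : ℝ} (ht : 0 < t) (hz : AffineMap.lineMap x y (-t) ∈ Ω)
    {φ : E →ᵃ[ℝ] ℝ} (hφ : φ ∈ missingHyperplanes Ω) : |φ y / φ x| ≤ (1 + t) / t := by
  have key : ∀ u ∈ Ω, ∀ v ∈ Ω, 0 < φ u → 0 < φ v := by
    intro u hu v hv hpos
    by_contra hneg
    have hvneg : φ v < 0 := lt_of_le_of_ne (not_lt.mp hneg) (hφ v hv)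
    have hd : 0 < φ u - φ v := by linarith
    have hs : AffineMap.lineMap u v (φ u / (φ u - φ v)) ∈ Ω :=
      hc.lineMap_mem hu hv ⟨by positivity, by rw [div_le_one hd]; linarith⟩
    apply hφ _ hs
    rw [AffineMap.apply_lineMap, AffineMap.lineMap_apply_ring']
    field_simp
    ring
  have hzval : φ (AffineMap.lineMap x y (-t)) = φ x - t * (φ y - φ x) := by
    rw [AffineMap.apply_lineMap, AffineMap.lineMap_apply_ring']
    ring
  rw [div_eq_mul_inv, abs_mul, abs_inv, ← div_eq_mul_inv, div_le_div_iff₀ (abs_pos.mpr (hφ x hx)) ht]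
  rcases lt_or_gt_of_ne (hφ x hx) with h | h
  · have hyn : φ y < 0 := by
      by_contra hh
      have := key y hy x hx (lt_of_le_of_ne (not_lt.mp hh) (hφ y hy).symm)
      linarith
    have hzn : φ (AffineMap.lineMap x y (-t)) < 0 := by
      by_contra hh
      have := key _ hz x hx (lt_of_le_of_ne (not_lt.mp hh) (hφ _ hz).symm)
      linarith
    rw [abs_of_neg h, abs_of_neg hyn]
    nlinarith
  · have hyp := key x hx y hy h
    have hzp := key x hx _ hz h
    rw [abs_of_pos h, abs_of_pos hyp]
    nlinarith

theorem bddAbove_hilbertDist [TopologicalSpace E] [IsTopologicalAddGroup E] [ContinuousSMul ℝ E]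
    {Ω : Set E} (ho : IsOpen Ω) (hc : Convex ℝ Ω) {x y : E} (hx : x ∈ Ω) (hy : y ∈ Ω) :
    BddAbove (Set.range fun p : missingHyperplanes Ω × missingHyperplanes Ω =>
      Real.log |crossRatio (p.1 : E →ᵃ[ℝ] ℝ) x y (p.2 : E →ᵃ[ℝ] ℝ)|) := by
  have ext : ∀ u ∈ Ω, ∀ v : E, ∃ t : ℝ, 0 < t ∧ AffineMap.lineMap u v (-t) ∈ Ω := by
    intro u hu v
    have hcont : Continuous fun t : ℝ => (AffineMap.lineMap u v (-t) : E) := by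
      simp only [AffineMap.lineMap_apply_module']
      fun_prop
    have hmem : ∀ᶠ t in 𝓝 (0 : ℝ), (AffineMap.lineMap u v (-t) : E) ∈ Ω :=
      hcont.continuousAt.eventually_mem (ho.mem_nhds (by simpa using hu))
    obtain ⟨t, h1, h2⟩ := ((hmem.filter_mono nhdsWithin_le_nhds).and
      (self_mem_nhdsWithin : Set.Ioi (0 : ℝ) ∈ 𝓝[>] (0 : ℝ))).exists
    exact ⟨t, h2, h1⟩
  obtain ⟨t, ht, hzt⟩ := ext x hx y
  obtain ⟨s, hs, hzs⟩ := ext y hy x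
  refine ⟨Real.log ((1 + s) / s * ((1 + t) / t)), ?_⟩
  rintro _ ⟨⟨⟨φ, hφ⟩, ⟨ψ, hψ⟩⟩, rfl⟩
  have h1 := abs_div_le_of_missing hc hx hy ht hzt hφ
  have h2 := abs_div_le_of_missing hc hy hx hs hzs hψ
  have hne : crossRatio φ x y ψ ≠ 0 :=
    mul_ne_zero (div_ne_zero (hψ x hx) (hψ y hy)) (div_ne_zero (hφ y hy) (hφ x hx))
  apply Real.log_le_log (abs_pos.mpr hne)
  rw [crossRatio, abs_mul]
  gcongr

end Hilbert

/-! ### Polytopes, faces and flags -/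

section Polytopes

variable {n : ℕ}

/-- A (bounded) convex polytope: the convex hull of finitely many points. -/
def IsPolytope (P : Set (EuclideanSpace ℝ (Fin n))) : Prop :=
  ∃ V : Finset (EuclideanSpace ℝ (Fin n)), P = convexHull ℝ (V : Set (EuclideanSpace ℝ (Fin n)))

/-- The faces of `P`: nonempty intersections of `P` with a supporting hyperplane, and `P` itself
(which is the locus where the zero functional is maximal). -/
def IsFace (P σ : Set (EuclideanSpace ℝ (Fin n))) : Prop :=
  σ.Nonempty ∧ IsExposed ℝ P σ

/-- The dimension of a face. -/
noncomputable def faceDim (σ : Set (EuclideanSpace ℝ (Fin n))) : ℕ :=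
  Module.finrank ℝ (vectorSpan ℝ σ)

/-- The flags of `P` (chains of faces for inclusion) that contain `P` itself. -/
@[ext] structure StarFlag (P : Set (EuclideanSpace ℝ (Fin n))) where
  faces : Set (Set (EuclideanSpace ℝ (Fin n)))
  isFace : ∀ σ ∈ faces, IsFace P σ
  isChain : IsChain (· ⊆ ·) faces
  self_mem : P ∈ faces

/-- The type of a flag: the set of the numbers `dim σ + 1` for its faces `σ ≠ P`. -/
def StarFlag.type {P : Set (EuclideanSpace ℝ (Fin n))} (F : StarFlag P) : Set ℕ :=
  {k | ∃ σ ∈ F.faces, σ ≠ P ∧ k = faceDim σ + 1}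

/-- The flag whose only face is `P`. -/
def trivialFlag (P : Set (EuclideanSpace ℝ (Fin n))) (hP : P.Nonempty) : StarFlag P where
  faces := {P}
  isFace := by
    rintro σ rfl
    exact ⟨hP, IsExposed.refl σ⟩
  isChain := Set.subsingleton_singleton.isChain
  self_mem := rfl

end Polytopes

/-! ### The model flat and the model Weyl chamber -/

/-- The model flat `ℝ^d / ℝ(1,…,1)`, with `d = n + 1`. -/
abbrev ModelFlat (n : ℕ) : Type :=
  (Fin (n + 1) → ℝ) ⧸ Submodule.span ℝ {(fun _ => 1 : Fin (n + 1) → ℝ)}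

/-- The difference `α i - α j` of two coordinates, as a linear form in the class `[α]`. -/
noncomputable def coordDiff {n : ℕ} (i j : Fin (n + 1)) : ModelFlat n →ₗ[ℝ] ℝ :=
  Submodule.liftQ _ (LinearMap.proj (R := ℝ) (φ := fun _ : Fin (n + 1) => ℝ) i -
    LinearMap.proj (R := ℝ) (φ := fun _ : Fin (n + 1) => ℝ) j)
    (by rw [Submodule.span_singleton_le_iff_mem]; simp)

/-- The norm of `[α]` is the maximum of the `|α i - α j|`. -/
noncomputable def hexNorm {n : ℕ} (a : ModelFlat n) : ℝ :=
  ⨆ p : Fin (n + 1) × Fin (n + 1), |coordDiff p.1 p.2 a|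

/-- The face of type `D ⊆ {1, …, d - 1}` of the closed Weyl chamber `α₁ ≥ … ≥ α_d`, cut out by
`α_k = α_{k+1}` for `k ∉ D`.  Coordinates are indexed from `0` in the code, so that `i : Fin n`
stands for `k = i + 1`. -/
def chamberFace (n : ℕ) (D : Set ℕ) : Set (ModelFlat n) :=
  {a | (∀ i : Fin n, 0 ≤ coordDiff i.castSucc i.succ a) ∧
    ∀ i : Fin n, (i : ℕ) + 1 ∉ D → coordDiff i.castSucc i.succ a = 0}

theorem zero_mem_chamberFace (n : ℕ) (D : Set ℕ) : (0 : ModelFlat n) ∈ chamberFace n D := by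
  simp [chamberFace]

/-! ### The geometric realization of the flag complex modeled on the Weyl chamber -/

section Realization

variable {n : ℕ}

/-- The disjoint union of the faces of the Weyl chamber indexed by the flags containing `P`. -/
abbrev ChamberUnion (P : Set (EuclideanSpace ℝ (Fin n))) : Type :=
  Σ F : StarFlag P, chamberFace n F.type

/-- The metric on the disjoint union, infinite between different pieces. -/
noncomputable def unionEDist {P : Set (EuclideanSpace ℝ (Fin n))} (u v : ChamberUnion P) : ℝ≥0∞ :=
  open Classical in
  if u.1 = v.1 then ENNReal.ofReal (hexNorm ((u.2 : ModelFlat n) - (v.2 : ModelFlat n))) else ⊤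

/-- The gluing relation: `(a, F) ∼ (a, F')` if `F` is contained in `F'`. -/
def glue {P : Set (EuclideanSpace ℝ (Fin n))} (u v : ChamberUnion P) : Prop :=
  u.1.faces ⊆ v.1.faces ∧ (u.2 : ModelFlat n) = (v.2 : ModelFlat n)

/-- The space `K`: the quotient of the disjoint union by the equivalence relation generated by the
gluing relation. -/
def ModelSpace (P : Set (EuclideanSpace ℝ (Fin n))) : Type :=
  Quot (glue (P := P))

/-- The class of a point of the disjoint union. -/
def ModelSpace.mk {P : Set (EuclideanSpace ℝ (Fin n))} (u : ChamberUnion P) : ModelSpace P :=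
  Quot.mk _ u

/-- The quotient metric: the infimum of the lengths `∑ d(u_k, v_k)` of the chains
`u_0, v_0, …, u_N, v_N` with `p = [u_0]`, `[v_k] = [u_{k+1}]` and `[v_N] = q`. -/
noncomputable def modelEDist {P : Set (EuclideanSpace ℝ (Fin n))} (p q : ModelSpace P) : ℝ≥0∞ :=
  ⨅ (N : ℕ) (u : Fin (N + 1) → ChamberUnion P) (v : Fin (N + 1) → ChamberUnion P)
    (_ : ModelSpace.mk (u 0) = p) (_ : ModelSpace.mk (v (Fin.last N)) = q)
    (_ : ∀ k : Fin N, ModelSpace.mk (v k.castSucc) = ModelSpace.mk (u k.succ)),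
    ∑ k, unionEDist (u k) (v k)

/-- The distance of `K` as a real number; it is finite by `modelEDist_ne_top`. -/
noncomputable def modelDist {P : Set (EuclideanSpace ℝ (Fin n))} (p q : ModelSpace P) : ℝ :=
  (modelEDist p q).toReal

/-- The cone point `o` of `K`, the common class of all `(0, F)`. -/
def conePoint (P : Set (EuclideanSpace ℝ (Fin n))) (hP : P.Nonempty) : ModelSpace P :=
  ModelSpace.mk ⟨trivialFlag P hP, 0, zero_mem_chamberFace n _⟩

theorem mk_zero_eq_conePoint {P : Set (EuclideanSpace ℝ (Fin n))} (hP : P.Nonempty)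
    (F : StarFlag P) :
    ModelSpace.mk ⟨F, 0, zero_mem_chamberFace n _⟩ = conePoint P hP :=
  (Quot.sound ⟨Set.singleton_subset_iff.mpr F.self_mem, rfl⟩).symm

theorem modelEDist_ne_top {P : Set (EuclideanSpace ℝ (Fin n))} (p q : ModelSpace P) :
    modelEDist p q ≠ ⊤ := by
  induction p using Quot.ind with | _ u => ?_
  induction q using Quot.ind with | _ v => ?_
  have hP : P.Nonempty := (u.1.isFace P u.1.self_mem).1
  let z : ∀ F : StarFlag P, ChamberUnion P := fun F => ⟨F, 0, zero_mem_chamberFace n _⟩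
  have hle : modelEDist (Quot.mk _ u) (Quot.mk _ v) ≤
      ∑ k, unionEDist ((![u, z v.1] : Fin 2 → ChamberUnion P) k)
        ((![z u.1, v] : Fin 2 → ChamberUnion P) k) := by
    refine iInf_le_of_le 1 (iInf_le_of_le ![u, z v.1] (iInf_le_of_le ![z u.1, v]
      (iInf_le_of_le rfl (iInf_le_of_le rfl (iInf_le_of_le ?_ le_rfl)))))
    intro k
    fin_cases k
    exact (mk_zero_eq_conePoint hP u.1).trans (mk_zero_eq_conePoint hP v.1).symm
  refine ne_top_of_le_ne_top ?_ hle
  simp [Fin.sum_univ_two, unionEDist, z]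

end Realization

/-! Both spaces are compared inside the real functions on the finite set of proper exposed faces
(the empty one included), with `osc` as a norm modulo constants.

Hilbert side: an affine function nonnegative on a polytope is a nonnegative combination of the forms
`faceForm σ`. Hence the supremum over hyperplanes is attained on these forms, and `logForms P` is an
isometric embedding (`hilbertDist_eq_osc`).

Model side: `embed` sends `(a, F)` to the function whose value at `σ` is the coordinate of `a` at
the least dimension of a face of `F` not inside `σ`. It respects the gluing, separates points of the
quotient, and its image modulo constants consists of the maxitive functions, those turning
intersections into maxima. It is isometric on each chamber, so `osc` bounds the path metric from
below. Conversely, maxitive functions are tropically convex, and the tropical segment joining two of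
them meets finitely many chambers and has total length at most their `osc` distance
(`modelDist_eq_osc`).

Comparison: an interior point is a combination of vertices with weights `exp (l * w v)`. A sum of
exponentials is its largest term up to a bounded factor, so the logarithm of the form of `σ`,
divided by `l`, is within `C / l` of the maximum of `w` off `σ` (`exists_logForms_bound`). These
maxima are maxitive, and every `embed u` is of this kind. The two images are thus uniformly `O(1 /
l)`-close modulo constants, which gives the Gromov–Hausdorff approximations. -/

/-! ### Oscillation of a finite family -/

section Osc

/-- The oscillation `max g - min g` of a finite family of real numbers. -/
noncomputable def osc {ι : Type*} (g : ι → ℝ) : ℝ := ⨆ p : ι × ι, (g p.1 - g p.2)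

theorem osc_le {ι : Type*} [Nonempty ι] {g : ι → ℝ} {c : ℝ} (h : ∀ i j, g i - g j ≤ c) :
    osc g ≤ c :=
  ciSup_le fun p => h p.1 p.2

/-- Oscillation ignores the additive constant `c`, so closeness is only ever needed up to a shift.
-/
theorem osc_le_of_abs_sub_le {ι : Type*} [Nonempty ι] {g h : ι → ℝ} {c C : ℝ}
    (H : ∀ i, |g i - h i - c| ≤ C) : osc (g - h) ≤ 2 * C :=
  osc_le fun i j => by
    have h1 := abs_le.mp (H i)
    have h2 := abs_le.mp (H j)
    simp only [Pi.sub_apply]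
    linarith

variable {ι : Type*} [Finite ι]

theorem le_osc (g : ι → ℝ) (i j : ι) : g i - g j ≤ osc g :=
  le_ciSup (f := fun p : ι × ι => g p.1 - g p.2) (Set.finite_range _).bddAbove (i, j)

theorem osc_nonneg [Nonempty ι] (g : ι → ℝ) : 0 ≤ osc g := by
  obtain ⟨i⟩ := ‹Nonempty ι›
  simpa using le_osc g i i

theorem osc_add_le [Nonempty ι] (g h : ι → ℝ) : osc (g + h) ≤ osc g + osc h :=
  osc_le fun i j => by
    have h1 := le_osc g i j
    have h2 := le_osc h i j
    simp only [Pi.add_apply]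
    linarith

theorem osc_sub_comm [Nonempty ι] (g h : ι → ℝ) : osc (g - h) = osc (h - g) := by
  have key : ∀ g h : ι → ℝ, osc (g - h) ≤ osc (h - g) := fun g h => osc_le fun i j => by
    have h1 := le_osc (h - g) j i
    simp only [Pi.sub_apply] at *
    linarith
  exact le_antisymm (key g h) (key h g)

theorem osc_sub_le [Nonempty ι] (g h k : ι → ℝ) : osc (g - k) ≤ osc (g - h) + osc (h - k) := by
  simpa using osc_add_le (g - h) (h - k)

end Osc

/-! ### Exposed faces of polytopes -/

section Faces

variable {n : ℕ} {P : Set (EuclideanSpace ℝ (Fin n))}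

/-- The proper exposed faces of `P`, the empty one included. -/
abbrev ProperFace (P : Set (EuclideanSpace ℝ (Fin n))) : Type :=
  {σ : Set (EuclideanSpace ℝ (Fin n)) // IsExposed ℝ P σ ∧ σ ≠ P}

theorem AffineMap.map_sum_smul {E : Type*} [AddCommGroup E] [Module ℝ E] (φ : E →ᵃ[ℝ] ℝ)
    {V : Finset E} {c : E → ℝ} (hc : ∑ v ∈ V, c v = 1) :
    φ (∑ v ∈ V, c v • v) = ∑ v ∈ V, c v * φ v := by
  have h : ∀ y, φ y = φ.linear y + φ 0 := fun y => by
    conv_lhs => rw [φ.decomp]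
    rfl
  have hv : ∀ v ∈ V, c v * φ v = φ.linear (c v • v) + c v * φ 0 := fun v _ => by
    rw [h v, map_smul, smul_eq_mul, mul_add]
  rw [h, map_sum, Finset.sum_congr rfl hv, Finset.sum_add_distrib, ← Finset.sum_mul, hc, one_mul]

theorem IsExposed.exists_form {σ : Set (EuclideanSpace ℝ (Fin n))} (hσ : IsExposed ℝ P σ) :
    ∃ φ : EuclideanSpace ℝ (Fin n) →ᵃ[ℝ] ℝ, ∀ y ∈ P, 0 ≤ φ y ∧ (φ y = 0 ↔ y ∈ σ) := by
  rcases σ.eq_empty_or_nonempty with rfl | ⟨x, hx⟩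
  · exact ⟨AffineMap.const ℝ _ 1, fun y _ => by simp⟩
  · obtain ⟨l, hl⟩ := hσ ⟨x, hx⟩
    refine ⟨AffineMap.const ℝ _ (l x) - (l : EuclideanSpace ℝ (Fin n) →ₗ[ℝ] ℝ).toAffineMap,
      fun y hy => ?_⟩
    rw [hl] at hx ⊢
    have hyx := hx.2 y hy
    change 0 ≤ l x - l y ∧ (l x - l y = 0 ↔ _)
    refine ⟨by linarith, fun h => ⟨hy, fun z hz => ?_⟩, fun h => ?_⟩
    · have := hx.2 z hz
      linarith
    · have := h.2 x hx.1
      linarith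

/-- The zero set, if nonempty, is where minus the linear part of `φ` is maximal on `P`. -/
theorem isExposed_zeroSet {φ : EuclideanSpace ℝ (Fin n) →ᵃ[ℝ] ℝ} (hφ : ∀ y ∈ P, 0 ≤ φ y) :
    IsExposed ℝ P {y ∈ P | φ y = 0} := by
  rintro ⟨x, hx, hx0⟩
  have h : ∀ y z, φ y - φ z = φ.linear y - φ.linear z := fun y z => by
    rw [← map_sub φ.linear, ← vsub_eq_sub y z, φ.linearMap_vsub, vsub_eq_sub]
  refine ⟨-LinearMap.toContinuousLinearMap φ.linear, ?_⟩
  ext y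
  simp only [Set.mem_ofPred_eq, neg_apply,
    LinearMap.coe_toContinuousLinearMap']
  refine and_congr_right fun hy => ⟨fun h0 z hz => ?_, fun H => ?_⟩
  · have := h z y
    have := hφ z hz
    linarith
  · have := h x y
    have := H x hx
    have := hφ y hy
    linarith

/-- An affine function that is nonnegative on `P` and vanishes exactly on the face `σ`. -/
noncomputable def faceForm (σ : ProperFace P) : EuclideanSpace ℝ (Fin n) →ᵃ[ℝ] ℝ :=
  σ.2.1.exists_form.choose

theorem faceForm_nonneg (σ : ProperFace P) {y : EuclideanSpace ℝ (Fin n)} (hy : y ∈ P) :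
    0 ≤ faceForm σ y :=
  (σ.2.1.exists_form.choose_spec y hy).1

theorem faceForm_eq_zero (σ : ProperFace P) {y : EuclideanSpace ℝ (Fin n)} (hy : y ∈ P) :
    faceForm σ y = 0 ↔ y ∈ σ.1 :=
  (σ.2.1.exists_form.choose_spec y hy).2

theorem faceForm_pos (σ : ProperFace P) {y : EuclideanSpace ℝ (Fin n)} (hy : y ∈ P)
    (hσ : y ∉ σ.1) : 0 < faceForm σ y :=
  (faceForm_nonneg σ hy).lt_of_ne fun h => hσ ((faceForm_eq_zero σ hy).mp h.symm)

/-- The empty face. -/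
def emptyFace (hne : P.Nonempty) : ProperFace P := ⟨∅, isExposed_empty, hne.ne_empty.symm⟩

/-- The intersection of two proper faces. -/
def interFace (σ τ : ProperFace P) : ProperFace P :=
  ⟨σ.1 ∩ τ.1, σ.2.1.inter τ.2.1, fun h =>
    σ.2.2 (Set.Subset.antisymm σ.2.1.subset (h.symm.subset.trans Set.inter_subset_left))⟩

/-- The form defining `σ` is constant along `σ` but not along `τ`, so its linear part kills only the
smaller direction space. -/
theorem faceDim_lt {σ τ : Set (EuclideanSpace ℝ (Fin n))} (hσ : IsExposed ℝ P σ)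
    (hne : σ.Nonempty) (hτ : τ ⊆ P) (hστ : σ ⊆ τ) (h : σ ≠ τ) : faceDim σ < faceDim τ := by
  obtain ⟨φ, hφ⟩ := hσ.exists_form
  obtain ⟨x, hx⟩ := hne
  obtain ⟨y, hy, hyσ⟩ := Set.exists_of_ssubset (hστ.ssubset_of_ne h)
  refine Submodule.finrank_lt_finrank_of_lt (lt_of_le_of_ne (vectorSpan_mono ℝ hστ) fun heq => ?_)
  have hker : vectorSpan ℝ σ ≤ LinearMap.ker φ.linear := by
    rw [vectorSpan_def, Submodule.span_le]
    rintro _ ⟨a, ha, b, hb, rfl⟩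
    have ha0 := (hφ a (hτ (hστ ha))).2.mpr ha
    have hb0 := (hφ b (hτ (hστ hb))).2.mpr hb
    rw [SetLike.mem_coe, LinearMap.mem_ker, φ.linearMap_vsub, ha0, hb0, vsub_self]
  have hmem : y -ᵥ x ∈ LinearMap.ker φ.linear :=
    hker (heq ▸ vsub_mem_vectorSpan ℝ hy (hστ hx))
  rw [LinearMap.mem_ker, φ.linearMap_vsub, (hφ x (hτ (hστ hx))).2.mpr hx] at hmem
  exact hyσ ((hφ y (hτ hy)).2.mp (by simpa using hmem))

theorem faceDim_le_of_subset {σ τ : Set (EuclideanSpace ℝ (Fin n))} (h : σ ⊆ τ) :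
    faceDim σ ≤ faceDim τ :=
  Submodule.finrank_mono (vectorSpan_mono ℝ h)

theorem faceDim_self (hc : Convex ℝ P) (hne : (interior P).Nonempty) : faceDim P = n := by
  rw [faceDim, ← direction_affineSpan, hc.interior_nonempty_iff_affineSpan_eq_top.mp hne,
    AffineSubspace.direction_top, finrank_top, finrank_euclideanSpace_fin]

theorem faceDim_le (σ : Set (EuclideanSpace ℝ (Fin n))) : faceDim σ ≤ n := by
  simpa [faceDim] using Submodule.finrank_le (vectorSpan ℝ σ)

/-! ### Faces and points in terms of the finite generating set `V`. -/

variable {V : Finset (EuclideanSpace ℝ (Fin n))}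

theorem exists_weights (hV : P = convexHull ℝ (V : Set (EuclideanSpace ℝ (Fin n))))
    {y : EuclideanSpace ℝ (Fin n)} (hy : y ∈ P) :
    ∃ c : EuclideanSpace ℝ (Fin n) → ℝ,
      (∀ v ∈ V, 0 ≤ c v) ∧ ∑ v ∈ V, c v = 1 ∧ ∑ v ∈ V, c v • v = y := by
  rwa [hV, Finset.mem_convexHull'] at hy

theorem vertex_mem (hV : P = convexHull ℝ (V : Set (EuclideanSpace ℝ (Fin n))))
    {v : EuclideanSpace ℝ (Fin n)} (hv : v ∈ V) : v ∈ P :=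
  hV ▸ subset_convexHull ℝ _ hv

theorem nonneg_of_vertices (hV : P = convexHull ℝ (V : Set (EuclideanSpace ℝ (Fin n))))
    {φ : EuclideanSpace ℝ (Fin n) →ᵃ[ℝ] ℝ} (h : ∀ v ∈ V, 0 ≤ φ v) : ∀ y ∈ P, 0 ≤ φ y := by
  intro y hy
  obtain ⟨c, hc, hc1, rfl⟩ := exists_weights hV hy
  rw [φ.map_sum_smul hc1]
  exact Finset.sum_nonneg fun v hv => mul_nonneg (hc v hv) (h v hv)

/-- A face is determined by the elements of `V` it contains: where the form of `τ` vanishes, every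
generator off `τ` has weight zero. -/
theorem subset_of_vertices (hV : P = convexHull ℝ (V : Set (EuclideanSpace ℝ (Fin n))))
    {σ τ : Set (EuclideanSpace ℝ (Fin n))} (hσ : IsExposed ℝ P σ) (hτ : IsExposed ℝ P τ)
    (h : ∀ v ∈ V, v ∈ τ → v ∈ σ) : τ ⊆ σ := by
  obtain ⟨φ, hφ⟩ := hσ.exists_form
  obtain ⟨ψ, hψ⟩ := hτ.exists_form
  intro y hy
  have hyP := hτ.subset hy
  have hy0 := (hψ y hyP).2.mpr hy
  rw [← (hφ y hyP).2]
  obtain ⟨c, hc, hc1, rfl⟩ := exists_weights hV hyP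
  rw [ψ.map_sum_smul hc1, Finset.sum_eq_zero_iff_of_nonneg fun v hv =>
    mul_nonneg (hc v hv) (hψ v (vertex_mem hV hv)).1] at hy0
  rw [φ.map_sum_smul hc1]
  refine Finset.sum_eq_zero fun v hv => ?_
  rcases mul_eq_zero.mp (hy0 v hv) with h0 | h0
  · rw [h0, zero_mul]
  · rw [(hφ v (vertex_mem hV hv)).2.mpr (h v hv ((hψ v (vertex_mem hV hv)).2.mp h0)), mul_zero]

theorem exists_vertex_notMem (hV : P = convexHull ℝ (V : Set (EuclideanSpace ℝ (Fin n))))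
    {σ τ : Set (EuclideanSpace ℝ (Fin n))} (hσ : IsExposed ℝ P σ) (hτ : IsExposed ℝ P τ)
    (h : ¬ τ ⊆ σ) : ∃ v ∈ V, v ∈ τ ∧ v ∉ σ := by
  by_contra! hcon
  exact h (subset_of_vertices hV hσ hτ hcon)

theorem ProperFace.not_subset (σ : ProperFace P) : ¬ P ⊆ σ.1 :=
  fun h => σ.2.2 (Set.Subset.antisymm σ.2.1.subset h)

theorem ProperFace.exists_vertex (hV : P = convexHull ℝ (V : Set (EuclideanSpace ℝ (Fin n))))
    (σ : ProperFace P) : ∃ v ∈ V, v ∉ σ.1 := by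
  obtain ⟨v, hv, -, hvσ⟩ := exists_vertex_notMem hV σ.2.1 (IsExposed.refl P) σ.not_subset
  exact ⟨v, hv, hvσ⟩

theorem finite_isExposed (hP : IsPolytope P) :
    Finite {σ : Set (EuclideanSpace ℝ (Fin n)) // IsExposed ℝ P σ} := by
  obtain ⟨V, hV⟩ := hP
  refine Finite.of_injective
    (fun σ : {σ : Set (EuclideanSpace ℝ (Fin n)) // IsExposed ℝ P σ} => {v : V | v.1 ∈ σ.1}) ?_
  intro σ τ h
  have hiff : ∀ v ∈ V, v ∈ σ.1 ↔ v ∈ τ.1 := fun v hv => Set.ext_iff.mp h ⟨v, hv⟩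
  exact Subtype.ext (Set.Subset.antisymm
    (subset_of_vertices hV τ.2 σ.2 fun v hv => (hiff v hv).mp)
    (subset_of_vertices hV σ.2 τ.2 fun v hv => (hiff v hv).mpr))

theorem finite_properFace (hP : IsPolytope P) : Finite (ProperFace P) := by
  have := finite_isExposed hP
  exact Finite.of_injective
    (fun σ : ProperFace P =>
      (⟨σ.1, σ.2.1⟩ : {σ : Set (EuclideanSpace ℝ (Fin n)) // IsExposed ℝ P σ}))
    fun σ τ h => Subtype.ext (Subtype.mk.inj h)

theorem exists_pos_weights (hV : P = convexHull ℝ (V : Set (EuclideanSpace ℝ (Fin n))))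
    {y : EuclideanSpace ℝ (Fin n)} (hy : y ∈ interior P) :
    ∃ c : EuclideanSpace ℝ (Fin n) → ℝ,
      (∀ v ∈ V, 0 < c v) ∧ ∑ v ∈ V, c v = 1 ∧ ∑ v ∈ V, c v • v = y := by
  have hne : V.Nonempty := by
    rw [Finset.nonempty_iff_ne_empty]
    rintro rfl
    have := interior_subset hy
    simp [hV] at this
  have hcard : (0 : ℝ) < V.card := by exact_mod_cast hne.card_pos
  set b : EuclideanSpace ℝ (Fin n) := ∑ v ∈ V, ((V.card : ℝ)⁻¹) • v with hb
  -- Moving `y` slightly away from the barycenter `b` stays in `P`. So `y` is a convex combination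
  -- of a point of `P` and `b`, and `b` contributes positive weight to every vertex.
  have hcont : Continuous fun t : ℝ => y + t • (y - b) := by fun_prop
  have hmem : ∀ᶠ t in 𝓝 (0 : ℝ), y + t • (y - b) ∈ interior P :=
    hcont.continuousAt.eventually_mem (isOpen_interior.mem_nhds (by simpa using hy))
  obtain ⟨t, h1, h2⟩ := ((hmem.filter_mono nhdsWithin_le_nhds).and
    (self_mem_nhdsWithin : Set.Ioi (0 : ℝ) ∈ 𝓝[>] (0 : ℝ))).exists
  have ht : (0 : ℝ) < t := h2
  obtain ⟨c, hc, hc1, hcy⟩ := exists_weights hV (interior_subset h1)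
  refine ⟨fun v => (1 + t)⁻¹ * (c v + t * (V.card : ℝ)⁻¹), fun v hv => ?_, ?_, ?_⟩
  · have := hc v hv
    positivity
  · rw [← Finset.mul_sum, Finset.sum_add_distrib, hc1, Finset.sum_const, nsmul_eq_mul]
    field_simp
  · simp_rw [mul_smul, add_smul]
    rw [← Finset.smul_sum, Finset.sum_add_distrib, hcy]
    simp_rw [mul_smul]
    rw [← Finset.smul_sum, ← hb]
    rw [show y + t • (y - b) + t • b = (1 + t) • y by module, smul_smul,
      inv_mul_cancel₀ (by positivity), one_smul]

/-- Otherwise a supporting functional attains its maximum at a combination with all weights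
positive, hence at every vertex. It is then constant on `P`, contradicting strict inequality at an
interior point. -/
theorem mem_interior_of_pos_weights
    (hV : P = convexHull ℝ (V : Set (EuclideanSpace ℝ (Fin n)))) (hne : (interior P).Nonempty)
    {c : EuclideanSpace ℝ (Fin n) → ℝ} (hc : ∀ v ∈ V, 0 < c v) (hc1 : ∑ v ∈ V, c v = 1) :
    ∑ v ∈ V, c v • v ∈ interior P := by
  have hconv : Convex ℝ P := hV ▸ convex_convexHull ℝ _
  by_contra hy
  obtain ⟨f, hf⟩ := geometric_hahn_banach_open_point hconv.interior isOpen_interior hy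
  set y := ∑ v ∈ V, c v • v
  have hle : ∀ z ∈ P, f z ≤ f y := by
    intro z hz
    have hz' : z ∈ closure (interior P) := by
      rw [hconv.closure_interior_eq_closure_of_nonempty_interior hne]
      exact subset_closure hz
    exact closure_minimal (fun w hw => (hf w hw).le)
      (isClosed_le f.continuous continuous_const) hz'
  have hfy : ∑ v ∈ V, c v * (f y - f v) = 0 := by
    simp_rw [mul_sub]
    rw [Finset.sum_sub_distrib, ← Finset.sum_mul, hc1, one_mul, sub_eq_zero]
    simp [y, map_sum]
  rw [Finset.sum_eq_zero_iff_of_nonneg fun v hv =>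
    mul_nonneg (hc v hv).le (sub_nonneg.mpr (hle v (vertex_mem hV hv)))] at hfy
  obtain ⟨x, hx⟩ := hne
  have hx' := hf x hx
  obtain ⟨e, -, he1, rfl⟩ := exists_weights hV (interior_subset hx)
  have : f (∑ v ∈ V, e v • v) = f y := by
    have hv : ∀ v ∈ V, f (e v • v) = e v * f y := fun v hv => by
      have := (mul_eq_zero.mp (hfy v hv)).resolve_left (hc v hv).ne'
      rw [map_smul, smul_eq_mul, show f v = f y by linarith]
    rw [map_sum, Finset.sum_congr rfl hv, ← Finset.sum_mul, he1, one_mul]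
  exact hx'.ne this

/-! ### The Hilbert metric through the forms of the faces. -/

theorem faceForm_pos_of_mem_interior (hP : IsPolytope P) (σ : ProperFace P)
    {y : EuclideanSpace ℝ (Fin n)} (hy : y ∈ interior P) : 0 < faceForm σ y := by
  obtain ⟨V, hV⟩ := hP
  obtain ⟨c, hc, hc1, rfl⟩ := exists_pos_weights hV hy
  obtain ⟨v, hv, hvσ⟩ := σ.exists_vertex hV
  rw [AffineMap.map_sum_smul _ hc1]
  exact Finset.sum_pos' (fun v hv => mul_nonneg (hc v hv).le (faceForm_nonneg σ (vertex_mem hV hv)))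
    ⟨v, hv, mul_pos (hc v hv) (faceForm_pos σ (vertex_mem hV hv) hvσ)⟩

/-- An inequality between values at two points that holds for the forms defining the faces holds
for all nonnegative affine functions, since these are nonnegative combinations of the former. -/
theorem le_mul_of_faceForm_le (hP : IsPolytope P) {y z : EuclideanSpace ℝ (Fin n)} (hy : y ∈ P)
    (hz : z ∈ P) {M : ℝ} (hM : ∀ σ : ProperFace P, faceForm σ y ≤ M * faceForm σ z)
    (φ : EuclideanSpace ℝ (Fin n) →ᵃ[ℝ] ℝ) (hφ : ∀ u ∈ P, 0 ≤ φ u) : φ y ≤ M * φ z := by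
  classical
  obtain ⟨V, hV⟩ := hP
  -- Induction on the number of generators where `φ` is nonzero: the largest multiple of the form of
  -- the zero face of `φ` that keeps `φ` nonnegative is subtracted, which creates a new zero at
  -- `v₁`.
  induction hN : (V.filter fun v => φ v ≠ 0).card using Nat.strong_induction_on generalizing φ with
  | _ N ih =>
  subst hN
  by_cases hP0 : {u ∈ P | φ u = 0} = P
  · have h0 : ∀ u ∈ P, φ u = 0 := fun u hu => (hP0.symm ▸ hu : u ∈ {u ∈ P | φ u = 0}).2
    rw [h0 y hy, h0 z hz, mul_zero]
  let σ : ProperFace P := ⟨{u ∈ P | φ u = 0}, isExposed_zeroSet hφ, hP0⟩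
  have hσV : ∀ v ∈ V, φ v ≠ 0 → 0 < faceForm σ v := fun v hv h =>
    faceForm_pos σ (vertex_mem hV hv) fun hmem => h hmem.2
  have hσ0 : ∀ v ∈ V, φ v = 0 → faceForm σ v = 0 := fun v hv h =>
    (faceForm_eq_zero σ (vertex_mem hV hv)).mpr ⟨vertex_mem hV hv, h⟩
  obtain ⟨v₀, hv₀, hv₀σ⟩ := σ.exists_vertex hV
  have hne : (V.filter fun v => φ v ≠ 0).Nonempty :=
    ⟨v₀, Finset.mem_filter.mpr ⟨hv₀, fun h => hv₀σ ⟨vertex_mem hV hv₀, h⟩⟩⟩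
  obtain ⟨v₁, hv₁, hmin⟩ := Finset.exists_min_image _ (fun v => φ v / faceForm σ v) hne
  obtain ⟨hv₁V, hv₁0⟩ := Finset.mem_filter.mp hv₁
  set t := φ v₁ / faceForm σ v₁ with ht
  have ht0 : 0 ≤ t := div_nonneg (hφ _ (vertex_mem hV hv₁V)) (hσV v₁ hv₁V hv₁0).le
  have happ : ∀ u, (φ - t • faceForm σ) u = φ u - t * faceForm σ u := fun u => by simp
  have hψ : ∀ u ∈ P, 0 ≤ (φ - t • faceForm σ) u := nonneg_of_vertices hV fun v hv => by
    rw [happ]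
    by_cases h : φ v = 0
    · rw [h, hσ0 v hv h]; simp
    · have := hmin v (Finset.mem_filter.mpr ⟨hv, h⟩)
      rw [le_div_iff₀ (hσV v hv h)] at this
      linarith
  have hlt : (V.filter fun v => (φ - t • faceForm σ) v ≠ 0).card <
      (V.filter fun v => φ v ≠ 0).card := by
    refine Finset.card_lt_card (Finset.ssubset_iff_subset_ne.mpr ⟨fun v hv => ?_, fun h => ?_⟩)
    · obtain ⟨hvV, hv0⟩ := Finset.mem_filter.mp hv
      refine Finset.mem_filter.mpr ⟨hvV, fun h => hv0 ?_⟩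
      rw [happ, h, hσ0 v hvV h]; simp
    · rw [← h] at hv₁
      refine (Finset.mem_filter.mp hv₁).2 ?_
      rw [happ, ht, div_mul_cancel₀ _ (hσV v₁ hv₁V hv₁0).ne', sub_self]
  have h1 := ih _ hlt _ hψ rfl
  rw [happ, happ] at h1
  have h2 := mul_le_mul_of_nonneg_left (hM σ) ht0
  linarith

/-- A form without zeros on the connected interior has constant sign there. The right choice of sign
makes it positive, and nonnegativity passes to the closure. -/
theorem pos_or_neg_of_missing (hc : Convex ℝ P) (hne : (interior P).Nonempty)
    {φ : EuclideanSpace ℝ (Fin n) →ᵃ[ℝ] ℝ} (hφ : φ ∈ missingHyperplanes (interior P)) :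
    ∃ ψ : EuclideanSpace ℝ (Fin n) →ᵃ[ℝ] ℝ, (∀ y ∈ P, 0 ≤ ψ y) ∧
      (∀ y ∈ interior P, 0 < ψ y) ∧ ∀ y, |φ y| = |ψ y| := by
  have hcont : Continuous φ := φ.continuous_of_finiteDimensional
  have hclosure : ∀ ψ : EuclideanSpace ℝ (Fin n) →ᵃ[ℝ] ℝ, (∀ y ∈ interior P, 0 < ψ y) →
      ∀ y ∈ P, 0 ≤ ψ y := by
    intro ψ hψ y hy
    have hy' : y ∈ closure (interior P) := by
      rw [hc.closure_interior_eq_closure_of_nonempty_interior hne]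
      exact subset_closure hy
    exact closure_minimal (fun w hw => (hψ w hw).le)
      (isClosed_le continuous_const ψ.continuous_of_finiteDimensional) hy'
  obtain ⟨x, hx⟩ := hne
  have hsame : ∀ y ∈ interior P, 0 < φ x * φ y := by
    intro y hy
    by_contra hneg
    have himg := (hc.interior.isPreconnected.image φ hcont.continuousOn).ordConnected
    have h0 : (0 : ℝ) ∈ φ '' interior P := by
      rcases mul_nonpos_iff.mp (not_lt.mp hneg) with h | h
      · exact himg.out ⟨y, hy, rfl⟩ ⟨x, hx, rfl⟩ ⟨h.2, h.1⟩
      · exact himg.out ⟨x, hx, rfl⟩ ⟨y, hy, rfl⟩ ⟨h.1, h.2⟩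
    obtain ⟨z, hz, hz0⟩ := h0
    exact hφ z hz hz0
  rcases lt_or_gt_of_ne (hφ x hx) with h | h
  · have hpos : ∀ y ∈ interior P, 0 < (-φ) y := fun y hy => by
      simpa using neg_of_mul_pos_right (hsame y hy) h.le
    exact ⟨-φ, hclosure _ hpos, hpos, fun y => by simp⟩
  · have hpos : ∀ y ∈ interior P, 0 < φ y := fun y hy => pos_of_mul_pos_right (hsame y hy) h.le
    exact ⟨φ, hclosure _ hpos, hpos, fun y => rfl⟩

/-- The vector of the logarithms of the forms that define the proper faces. -/
noncomputable def logForms (P : Set (EuclideanSpace ℝ (Fin n))) (y : EuclideanSpace ℝ (Fin n))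
    (σ : ProperFace P) : ℝ :=
  Real.log (faceForm σ y)

/-- The Hilbert metric of a polytope is the oscillation norm in logarithmic coordinates. -/
theorem hilbertDist_eq_osc (hP : IsPolytope P) {y z : EuclideanSpace ℝ (Fin n)}
    (hy : y ∈ interior P) (hz : z ∈ interior P) :
    hilbertDist (interior P) y z = osc (logForms P y - logForms P z) := by
  have := finite_properFace hP
  have : Nonempty (ProperFace P) := ⟨emptyFace ⟨y, interior_subset hy⟩⟩
  have hconv : Convex ℝ P := by
    obtain ⟨V, hV⟩ := hP
    exact hV ▸ convex_convexHull ℝ _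
  have hmiss : ∀ σ : ProperFace P, faceForm σ ∈ missingHyperplanes (interior P) := fun σ u hu =>
    (faceForm_pos_of_mem_interior hP σ hu).ne'
  have hval : ∀ φ ψ : EuclideanSpace ℝ (Fin n) →ᵃ[ℝ] ℝ, φ y ≠ 0 → φ z ≠ 0 → ψ y ≠ 0 → ψ z ≠ 0 →
      Real.log |crossRatio φ y z ψ| =
        (Real.log |ψ y| - Real.log |ψ z|) - (Real.log |φ y| - Real.log |φ z|) := by
    intro φ ψ h1 h2 h3 h4
    simp only [Real.log_abs]
    rw [crossRatio, Real.log_mul (by positivity) (by positivity), Real.log_div h3 h4,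
      Real.log_div h2 h1]
    ring
  have : Nonempty (missingHyperplanes (interior P) × missingHyperplanes (interior P)) :=
    ⟨⟨_, hmiss (Classical.arbitrary _)⟩, ⟨_, hmiss (Classical.arbitrary _)⟩⟩
  refine le_antisymm (ciSup_le ?_) (osc_le fun σ τ => ?_)
  -- The face form with the largest log ratio dominates every missing hyperplane; applying this in
  -- both directions bounds the two factors of the cross-ratio.
  · have key : ∀ y ∈ interior P, ∀ z ∈ interior P, ∃ σ : ProperFace P,
        ∀ φ ∈ missingHyperplanes (interior P), Real.log |φ y| - Real.log |φ z| ≤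
          logForms P y σ - logForms P z σ := by
      intro y hy z hz
      obtain ⟨σ, hσ⟩ := Finite.exists_max fun σ => logForms P y σ - logForms P z σ
      refine ⟨σ, fun φ hφ => ?_⟩
      obtain ⟨ψ, hψ, hψpos, habs⟩ := pos_or_neg_of_missing hconv ⟨y, hy⟩ hφ
      rw [habs, habs, abs_of_pos (hψpos y hy), abs_of_pos (hψpos z hz)]
      have := le_mul_of_faceForm_le hP (interior_subset hy) (interior_subset hz)
        (M := Real.exp (logForms P y σ - logForms P z σ)) (fun τ => by
          rw [← Real.log_le_log_iff (faceForm_pos_of_mem_interior hP τ hy) (mul_pos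
            (Real.exp_pos _) (faceForm_pos_of_mem_interior hP τ hz)),
            Real.log_mul (Real.exp_pos _).ne' (faceForm_pos_of_mem_interior hP τ hz).ne',
            Real.log_exp]
          have := hσ τ
          simp only [logForms] at this ⊢
          linarith) ψ hψ
      rw [← Real.log_le_log_iff (hψpos y hy) (mul_pos (Real.exp_pos _) (hψpos z hz)),
        Real.log_mul (Real.exp_pos _).ne' (hψpos z hz).ne', Real.log_exp] at this
      linarith
    obtain ⟨σ, hσ⟩ := key y hy z hz
    obtain ⟨τ, hτ⟩ := key z hz y hy
    rintro ⟨⟨φ, hφ⟩, ⟨ψ, hψ⟩⟩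
    rw [hval φ ψ (hφ y hy) (hφ z hz) (hψ y hy) (hψ z hz)]
    have h1 := hσ ψ hψ
    have h2 := hτ φ hφ
    have h3 := le_osc (logForms P y - logForms P z) σ τ
    simp only [Pi.sub_apply] at h3
    linarith
  · have h := le_ciSup (bddAbove_hilbertDist isOpen_interior hconv.interior hy hz)
      (⟨⟨_, hmiss τ⟩, ⟨_, hmiss σ⟩⟩ :
        missingHyperplanes (interior P) × missingHyperplanes (interior P))
    refine le_trans (le_of_eq ?_) h
    simp only
    rw [hval _ _ (hmiss τ y hy) (hmiss τ z hz) (hmiss σ y hy) (hmiss σ z hz)]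
    simp only [Real.log_abs, Pi.sub_apply, logForms]

end Faces

/-! ### Coordinates on the model flat -/

section Flat

variable {n : ℕ}

theorem coordDiff_mk (i j : Fin (n + 1)) (α : Fin (n + 1) → ℝ) :
    coordDiff i j (Submodule.Quotient.mk α) = α i - α j := by
  simp [coordDiff]

/-- The coordinate `α k - α 0` of the class `[α]`, constant for `k ≥ n`. -/
noncomputable def coordAt (k : ℕ) : ModelFlat n →ₗ[ℝ] ℝ :=
  coordDiff ⟨min k n, by omega⟩ 0

theorem coordDiff_eq_coordAt (i j : Fin (n + 1)) (a : ModelFlat n) :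
    coordDiff i j a = coordAt i a - coordAt j a := by
  induction a using Submodule.Quotient.induction_on with | _ α =>
  have hi : (⟨min (i : ℕ) n, by omega⟩ : Fin (n + 1)) = i := Fin.ext (by simp; omega)
  have hj : (⟨min (j : ℕ) n, by omega⟩ : Fin (n + 1)) = j := Fin.ext (by simp; omega)
  rw [coordAt, coordAt, coordDiff_mk, coordDiff_mk, coordDiff_mk, hi, hj]
  ring

theorem coordAt_sub_coordAt (k l : ℕ) (a : ModelFlat n) :
    coordAt k a - coordAt l a = coordDiff ⟨min k n, by omega⟩ ⟨min l n, by omega⟩ a := by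
  induction a using Submodule.Quotient.induction_on with | _ α =>
  rw [coordAt, coordAt, coordDiff_mk, coordDiff_mk, coordDiff_mk]
  ring

theorem coordAt_zero (a : ModelFlat n) : coordAt 0 a = 0 := by
  induction a using Submodule.Quotient.induction_on with | _ α =>
  rw [coordAt, coordDiff_mk]
  simp

theorem coordAt_antitone {D : Set ℕ} {a : ModelFlat n} (ha : a ∈ chamberFace n D) :
    Antitone fun k => coordAt k a := by
  refine antitone_nat_of_succ_le fun k => ?_
  by_cases hk : k < n
  · have := ha.1 ⟨k, hk⟩
    rw [coordDiff_eq_coordAt] at this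
    simpa using this
  · have h := coordAt_sub_coordAt k (k + 1) a
    rw [coordDiff_eq_coordAt] at h
    simp only [show min k n = n by omega, show min (k + 1) n = n by omega, sub_self] at h
    linarith

/-- With coordinates indexed from `0`, the step from `m` to `m + 1` is governed by `m + 1 ∈ D`, that
is, by a flag face of dimension `m`. -/
theorem coordAt_eq_of_le {D : Set ℕ} {c : ModelFlat n}
    (hc : ∀ i : Fin n, (i : ℕ) + 1 ∉ D → coordDiff i.castSucc i.succ c = 0) {k l : ℕ} (hkl : k ≤ l)
    (hln : l ≤ n) (h : ∀ m, k ≤ m → m < l → m + 1 ∉ D) : coordAt k c = coordAt l c := by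
  induction l, hkl using Nat.le_induction with
  | base => rfl
  | succ l hkl ih =>
    rw [ih (by omega) fun m h1 h2 => h m h1 (by omega)]
    have := hc ⟨l, by omega⟩ (h l hkl (by omega))
    rw [coordDiff_eq_coordAt] at this
    simp only [Fin.val_castSucc, Fin.val_succ] at this
    linarith

theorem coordDiff_le_hexNorm (i j : Fin (n + 1)) (a : ModelFlat n) :
    coordDiff i j a ≤ hexNorm a :=
  (le_abs_self _).trans (le_ciSup (f := fun p : Fin (n + 1) × Fin (n + 1) => |coordDiff p.1 p.2 a|)
    (Set.finite_range _).bddAbove (i, j))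

theorem eq_zero_of_hexNorm_le {a : ModelFlat n} (ha : hexNorm a ≤ 0) : a = 0 := by
  have h : ∀ i j, coordDiff i j a ≤ 0 := fun i j => (coordDiff_le_hexNorm i j a).trans ha
  induction a using Submodule.Quotient.induction_on with | _ α =>
  rw [Submodule.Quotient.mk_eq_zero, Submodule.mem_span_singleton]
  refine ⟨α 0, funext fun i => ?_⟩
  have h1 := h i 0
  have h2 := h 0 i
  rw [coordDiff_mk] at h1 h2
  simp only [Pi.smul_apply, smul_eq_mul, mul_one]
  linarith

theorem chamberFace_mono {D D' : Set ℕ} (h : D ⊆ D') : chamberFace n D ⊆ chamberFace n D' :=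
  fun _ ha => ⟨ha.1, fun i hi => ha.2 i fun hD => hi (h hD)⟩

end Flat

/-! ### Coordinates on the realization of the flag complex -/

section Coordinates

variable {n : ℕ} {P : Set (EuclideanSpace ℝ (Fin n))}

theorem StarFlag.type_mono {F F' : StarFlag P} (h : F.faces ⊆ F'.faces) : F.type ⊆ F'.type :=
  fun _ ⟨σ, hσ, hne, hk⟩ => ⟨σ, h hσ, hne, hk⟩

/-- Within a chain, strict inclusion strictly raises the dimension, so dimensions recover the order.
-/
theorem StarFlag.subset_of_faceDim_le (F : StarFlag P) {σ τ : Set (EuclideanSpace ℝ (Fin n))}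
    (hσ : σ ∈ F.faces) (hτ : τ ∈ F.faces) (h : faceDim σ ≤ faceDim τ) : σ ⊆ τ := by
  rcases F.isChain.total hσ hτ with h' | h'
  · exact h'
  · by_contra hcon
    exact absurd (faceDim_lt (F.isFace τ hτ).2 (F.isFace τ hτ).1 (F.isFace σ hσ).2.subset h'
      fun heq => hcon heq.superset) (by omega)

theorem StarFlag.exists_greatest (F : StarFlag P) {A : Set (Set (EuclideanSpace ℝ (Fin n)))}
    (hA : A ⊆ F.faces) : ∃ ρ, IsExposed ℝ P ρ ∧ (ρ = ∅ ∨ ρ ∈ A) ∧ ∀ τ ∈ A, τ ⊆ ρ := by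
  rcases A.eq_empty_or_nonempty with rfl | hne
  · exact ⟨∅, isExposed_empty, Or.inl rfl, by simp⟩
  · have hb : BddAbove (faceDim '' A) := ⟨n, by rintro _ ⟨τ, -, rfl⟩; exact faceDim_le τ⟩
    obtain ⟨ρ, hρ, hmax⟩ := Nat.sSup_mem (hne.image faceDim) hb
    refine ⟨ρ, (F.isFace ρ (hA hρ)).2, Or.inr hρ, fun τ hτ => ?_⟩
    exact F.subset_of_faceDim_le (hA hτ) (hA hρ) (hmax ▸ le_csSup hb ⟨τ, hτ, rfl⟩)

/-- The least dimension of a face of the flag `F` that is not contained in `σ`. -/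
noncomputable def minDim (F : StarFlag P) (σ : ProperFace P) : ℕ :=
  sInf {k | ∃ τ ∈ F.faces, ¬ τ ⊆ σ.1 ∧ faceDim τ = k}

theorem minDim_spec (F : StarFlag P) (σ : ProperFace P) :
    ∃ τ ∈ F.faces, ¬ τ ⊆ σ.1 ∧ faceDim τ = minDim F σ :=
  Nat.sInf_mem (s := {k | ∃ τ ∈ F.faces, ¬ τ ⊆ σ.1 ∧ faceDim τ = k})
    ⟨_, P, F.self_mem, σ.not_subset, rfl⟩

theorem minDim_le {F : StarFlag P} {σ : ProperFace P} {τ : Set (EuclideanSpace ℝ (Fin n))}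
    (hτ : τ ∈ F.faces) (h : ¬ τ ⊆ σ.1) : minDim F σ ≤ faceDim τ :=
  Nat.sInf_le ⟨τ, hτ, h, rfl⟩

theorem minDim_le_dim (F : StarFlag P) (σ : ProperFace P) : minDim F σ ≤ n :=
  (minDim_le F.self_mem σ.not_subset).trans (faceDim_le P)

theorem StarFlag.not_subset_of_minDim_le {F : StarFlag P} {σ : ProperFace P}
    {τ : Set (EuclideanSpace ℝ (Fin n))} (hτ : τ ∈ F.faces) (h : minDim F σ ≤ faceDim τ) :
    ¬ τ ⊆ σ.1 := by
  obtain ⟨τ', hτ', hnot, hdim⟩ := minDim_spec F σ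
  exact fun hsub => hnot ((F.subset_of_faceDim_le hτ' hτ (hdim ▸ h)).trans hsub)

/-- The coordinates of a point of the disjoint union of the chambers, indexed by the proper faces:
the asymptotic logarithmic rates of the forms that define the faces. -/
noncomputable def embed (u : ChamberUnion P) (σ : ProperFace P) : ℝ :=
  coordAt (minDim u.1 σ) (u.2 : ModelFlat n)

/-- Enlarging the flag may lower `minDim`, but only across dimensions of no face of the smaller
flag, where the coordinates do not jump. -/
theorem embed_eq_of_glue {u v : ChamberUnion P} (h : glue u v) : embed u = embed v := by
  obtain ⟨F, a⟩ := u
  obtain ⟨F', a'⟩ := v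
  obtain ⟨hF, ha⟩ := h
  simp only at hF ha
  funext σ
  simp only [embed, ← ha]
  have hle : minDim F' σ ≤ minDim F σ := by
    obtain ⟨τ, hτ, hnot, hdim⟩ := minDim_spec F σ
    exact hdim ▸ minDim_le (hF hτ) hnot
  refine (coordAt_eq_of_le a.2.2 hle (minDim_le_dim F σ) fun m h1 h2 => ?_).symm
  rintro ⟨τ, hτ, -, hdim⟩
  have h3 := minDim_le hτ (StarFlag.not_subset_of_minDim_le (σ := σ) (hF hτ) (by omega))
  omega

/-- This normalization removes the ambiguity of the additive constant. No flag face has dimension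
below `minDim` of the empty face, so the coordinate there equals the zeroth. -/
theorem embed_emptyFace (hne : P.Nonempty) (u : ChamberUnion P) :
    embed u (emptyFace hne) = 0 := by
  rw [embed, ← coordAt_zero (u.2 : ModelFlat n)]
  refine (coordAt_eq_of_le u.2.2.2 (Nat.zero_le _) (minDim_le_dim _ _) fun m _ h => ?_).symm
  rintro ⟨τ, hτ, -, hdim⟩
  have hnot : ¬ τ ⊆ (emptyFace hne).1 := fun hsub =>
    (u.1.isFace τ hτ).1.ne_empty (Set.subset_empty_iff.mp hsub)
  have := minDim_le hτ hnot
  omega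

/-- The witness is the largest flag face of dimension below `i`, or the empty face. The next flag
face has dimension `minDim F σ`, and no jump occurs between `i` and it. -/
theorem StarFlag.exists_coordAt_eq (hc : Convex ℝ P) (hne : (interior P).Nonempty) (F : StarFlag P)
    {i : ℕ} (hi : i ≤ n) : ∃ σ : ProperFace P, ∀ c : ModelFlat n,
      (∀ i : Fin n, (i : ℕ) + 1 ∉ F.type → coordDiff i.castSucc i.succ c = 0) →
        coordAt i c = coordAt (minDim F σ) c := by
  obtain ⟨ρ, hρ, hmem, hgr⟩ := F.exists_greatest (A := {τ ∈ F.faces | faceDim τ < i}) fun τ hτ => hτ.1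
  have hρP : ρ ≠ P := by
    rintro rfl
    rcases hmem with h | h
    · obtain ⟨x, hx⟩ := hne
      exact absurd (interior_subset hx) (h ▸ Set.notMem_empty x)
    · have := h.2
      rw [faceDim_self hc hne] at this
      omega
  refine ⟨⟨ρ, hρ, hρP⟩, fun c h => coordAt_eq_of_le h ?_ (minDim_le_dim _ _) fun m h1 h2 => ?_⟩
  · obtain ⟨τ, hτ, hnot, hdim⟩ := minDim_spec F ⟨ρ, hρ, hρP⟩
    by_contra hlt
    exact hnot (hgr τ ⟨hτ, by omega⟩)
  · rintro ⟨τ, hτ, -, hdim⟩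
    have hnot : ¬ τ ⊆ ρ := by
      intro hsub
      rcases hmem with rfl | h
      · exact (F.isFace τ hτ).1.ne_empty (Set.subset_empty_iff.mp hsub)
      · have := faceDim_le_of_subset hsub
        have := h.2
        omega
    have := minDim_le (σ := ⟨ρ, hρ, hρP⟩) hτ hnot
    omega

/-- The coordinates are isometric on each chamber. -/
theorem osc_embed_sub (hP : IsPolytope P) (hne : (interior P).Nonempty) (F : StarFlag P)
    (a b : chamberFace n F.type) :
    osc (embed ⟨F, a⟩ - embed ⟨F, b⟩) = hexNorm ((a : ModelFlat n) - (b : ModelFlat n)) := by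
  have := finite_properFace hP
  have : Nonempty (ProperFace P) := ⟨emptyFace (hne.mono interior_subset)⟩
  have hconv : Convex ℝ P := by
    obtain ⟨V, hV⟩ := hP
    exact hV ▸ convex_convexHull ℝ _
  have hval : ∀ σ, (embed ⟨F, a⟩ - embed ⟨F, b⟩) σ =
      coordAt (minDim F σ) ((a : ModelFlat n) - (b : ModelFlat n)) := fun σ => by
    rw [map_sub]
    rfl
  refine le_antisymm (osc_le fun σ τ => ?_) (ciSup_le fun p => ?_)
  · rw [hval, hval, coordAt_sub_coordAt]
    exact coordDiff_le_hexNorm _ _ _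
  · have hc : ∀ i : Fin n, (i : ℕ) + 1 ∉ F.type →
        coordDiff i.castSucc i.succ ((a : ModelFlat n) - (b : ModelFlat n)) = 0 := fun i hi => by
      rw [map_sub, a.2.2 i hi, b.2.2 i hi, sub_self]
    obtain ⟨σ, hσ⟩ := F.exists_coordAt_eq hconv hne (Nat.lt_succ_iff.mp p.1.2)
    obtain ⟨τ, hτ⟩ := F.exists_coordAt_eq hconv hne (Nat.lt_succ_iff.mp p.2.2)
    rw [coordDiff_eq_coordAt, hσ _ hc, hτ _ hc, ← hval, ← hval, abs_le]
    have h1 := le_osc (embed ⟨F, a⟩ - embed ⟨F, b⟩) σ τ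
    have h2 := le_osc (embed ⟨F, a⟩ - embed ⟨F, b⟩) τ σ
    constructor <;> linarith

theorem exists_glue {u : ChamberUnion P} {F : StarFlag P} (h : u.1.faces ⊆ F.faces) :
    ∃ v : ChamberUnion P, v.1 = F ∧ glue u v :=
  ⟨⟨F, u.2, chamberFace_mono (StarFlag.type_mono h) u.2.2⟩, rfl, h, rfl⟩

/-- Every point lies in a chamber all of whose walls it avoids. -/
theorem exists_glue_strict (u : ChamberUnion P) : ∃ v : ChamberUnion P, glue v u ∧
    ∀ σ ∈ v.1.faces, σ ≠ P → coordAt (faceDim σ + 1) (v.2 : ModelFlat n) <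
      coordAt (faceDim σ) (v.2 : ModelFlat n) := by
  obtain ⟨F, a, ha⟩ := u
  -- The faces at which `a` does not jump are discarded.
  let F' : StarFlag P :=
    { faces := {σ ∈ F.faces | σ ≠ P → coordAt (faceDim σ + 1) a < coordAt (faceDim σ) a}
      isFace := fun σ hσ => F.isFace σ hσ.1
      isChain := F.isChain.mono fun σ hσ => hσ.1
      self_mem := ⟨F.self_mem, fun h => absurd rfl h⟩ }
  refine ⟨⟨F', a, ha.1, fun i hi => ?_⟩, ⟨fun σ hσ => hσ.1, rfl⟩, fun σ hσ => hσ.2⟩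
  by_contra h0
  have hD : (i : ℕ) + 1 ∈ F.type := by
    by_contra hD
    exact h0 (ha.2 i hD)
  obtain ⟨σ, hσ, hσP, hdim⟩ := hD
  refine hi ⟨σ, ⟨hσ, fun _ => ?_⟩, hσP, hdim⟩
  have hdim' : faceDim σ = i := by omega
  rw [hdim']
  have h1 := lt_of_le_of_ne (ha.1 i) (Ne.symm h0)
  rw [coordDiff_eq_coordAt] at h1
  simpa using h1

/-- Let `ρ` be the largest face of `v` inside `σ`. The function of `v` takes equal values at `ρ` and
`σ`, whereas the jump of `u` at `σ` would separate them if `σ ⊈ ρ`. Hence `σ = ρ` belongs to `v`. -/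
theorem faces_subset_of_embed_eq {u v : ChamberUnion P} (h : embed u = embed v)
    (hu : ∀ σ ∈ u.1.faces, σ ≠ P → coordAt (faceDim σ + 1) (u.2 : ModelFlat n) <
      coordAt (faceDim σ) (u.2 : ModelFlat n)) : u.1.faces ⊆ v.1.faces := by
  intro σ hσ
  by_cases hσP : σ = P
  · exact hσP ▸ v.1.self_mem
  have hface := u.1.isFace σ hσ
  let σ' : ProperFace P := ⟨σ, hface.2, hσP⟩
  obtain ⟨ρ, hρ, hmem, hgr⟩ := v.1.exists_greatest (A := {τ ∈ v.1.faces | τ ⊆ σ}) fun τ hτ => hτ.1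
  have hρσ : ρ ⊆ σ := by
    rcases hmem with rfl | h
    · exact Set.empty_subset _
    · exact h.2
  let ρ' : ProperFace P := ⟨ρ, hρ, fun h => σ'.not_subset (h ▸ hρσ)⟩
  have hmin : minDim v.1 ρ' = minDim v.1 σ' := by
    unfold minDim
    congr 1
    ext k
    refine exists_congr fun τ => and_congr_right fun hτ => and_congr_left' (not_congr ?_)
    exact ⟨fun h => h.trans hρσ, fun h => hgr τ ⟨hτ, h⟩⟩
  have heq : embed u ρ' = embed u σ' := by rw [h, embed, embed, hmin]
  have hle : embed u σ' ≤ coordAt (faceDim σ + 1) (u.2 : ModelFlat n) := by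
    refine coordAt_antitone u.2.2 ?_
    obtain ⟨τ, hτ, hnot, hdim⟩ := minDim_spec u.1 σ'
    rw [← hdim]
    by_contra! hcon
    exact hnot (u.1.subset_of_faceDim_le hτ hσ (Nat.lt_succ_iff.mp hcon))
  have hσρ : σ ⊆ ρ := by
    by_contra hnot
    have h1 : coordAt (faceDim σ) (u.2 : ModelFlat n) ≤ embed u ρ' :=
      coordAt_antitone u.2.2 (minDim_le (σ := ρ') hσ hnot)
    have h2 := hu σ hσ hσP
    linarith
  obtain rfl : ρ = σ := hρσ.antisymm hσρ
  rcases hmem with h | h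
  · exact absurd h hface.1.ne_empty
  · exact h.1

theorem mk_eq_of_glue {u v : ChamberUnion P} (h : glue u v) : ModelSpace.mk u = ModelSpace.mk v :=
  Quot.sound h

/-- The coordinates separate the points of the realization. -/
theorem mk_eq_of_embed_eq (hP : IsPolytope P) (hne : (interior P).Nonempty) {u v : ChamberUnion P}
    (h : embed u = embed v) : ModelSpace.mk u = ModelSpace.mk v := by
  have : Nonempty (ProperFace P) := ⟨emptyFace (hne.mono interior_subset)⟩
  obtain ⟨u', hu', hstrict⟩ := exists_glue_strict u
  have h' : embed u' = embed v := (embed_eq_of_glue hu').trans h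
  obtain ⟨w, hw, huw⟩ := exists_glue (faces_subset_of_embed_eq h' hstrict)
  have hwv : embed w = embed v := (embed_eq_of_glue huw).symm.trans h'
  rw [← mk_eq_of_glue hu', mk_eq_of_glue huw]
  obtain ⟨F, a⟩ := w
  obtain ⟨F', b⟩ := v
  obtain rfl : F = F' := hw
  congr 2
  refine Subtype.ext (sub_eq_zero.mp (eq_zero_of_hexNorm_le ?_))
  rw [← osc_embed_sub hP hne, hwv]
  exact osc_le fun i j => by simp

end Coordinates

/-! ### The image of the coordinates -/

section Maxitive

variable {n : ℕ} {P : Set (EuclideanSpace ℝ (Fin n))}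

/-- A function of the proper faces that sends intersections to maxima. -/
def IsMaxitive (β : ProperFace P → ℝ) : Prop :=
  ∀ σ τ, β (interFace σ τ) = max (β σ) (β τ)

theorem IsMaxitive.antitone {β : ProperFace P → ℝ} (hβ : IsMaxitive β) {σ τ : ProperFace P}
    (h : σ.1 ⊆ τ.1) : β τ ≤ β σ := by
  have h1 : interFace σ τ = σ := Subtype.ext (Set.inter_eq_left.mpr h)
  have h2 := hβ σ τ
  rw [h1] at h2
  exact h2 ▸ le_max_right _ _

theorem IsMaxitive.max {β β' : ProperFace P → ℝ} (hβ : IsMaxitive β) (hβ' : IsMaxitive β') :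
    IsMaxitive fun σ => max (β σ) (β' σ) := fun σ τ => by
  simp only [hβ σ τ, hβ' σ τ]
  exact max_max_max_comm _ _ _ _

theorem IsMaxitive.add_const {β : ProperFace P → ℝ} (hβ : IsMaxitive β) (t : ℝ) :
    IsMaxitive fun σ => β σ + t := fun σ τ => by
  simp only [hβ σ τ, max_add_add_right]

/-- A face escapes `σ ∩ τ` iff it escapes `σ` or `τ`, so `minDim` takes a minimum, which decreasing
coordinates turn into a maximum. -/
theorem isMaxitive_embed (u : ChamberUnion P) : IsMaxitive (embed u) := by
  intro σ τ
  have h : minDim u.1 (interFace σ τ) = min (minDim u.1 σ) (minDim u.1 τ) := by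
    refine le_antisymm (le_min ?_ ?_) ?_
    · obtain ⟨κ, hκ, hnot, hdim⟩ := minDim_spec u.1 σ
      exact hdim ▸ minDim_le hκ fun hsub => hnot (hsub.trans Set.inter_subset_left)
    · obtain ⟨κ, hκ, hnot, hdim⟩ := minDim_spec u.1 τ
      exact hdim ▸ minDim_le hκ fun hsub => hnot (hsub.trans Set.inter_subset_right)
    · obtain ⟨κ, hκ, hnot, hdim⟩ := minDim_spec u.1 (interFace σ τ)
      rw [← hdim]
      by_cases h1 : κ ⊆ σ.1
      · exact (min_le_right _ _).trans (minDim_le hκ fun h2 => hnot (Set.subset_inter h1 h2))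
      · exact (min_le_left _ _).trans (minDim_le hκ h1)
  rw [embed, h]
  exact (coordAt_antitone u.2.2).map_min

/-- The sublevel sets of a maxitive function are the sets of faces that contain a given one. -/
theorem IsMaxitive.exists_threshold (hP : IsPolytope P) {β : ProperFace P → ℝ} (hβ : IsMaxitive β)
    (s : ℝ) : ∃ ρ, IsExposed ℝ P ρ ∧ ∀ σ : ProperFace P, ρ ⊆ σ.1 ↔ β σ < s := by
  have := finite_properFace hP
  by_cases hne : {σ : ProperFace P | β σ < s}.Nonempty
  · obtain ⟨ρ, hρ⟩ := (Set.toFinite {σ : ProperFace P | β σ < s}).exists_minimal hne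
    refine ⟨ρ.1, ρ.2.1, fun σ => ⟨fun h => (hβ.antitone h).trans_lt hρ.1, fun h => ?_⟩⟩
    have hmem : interFace ρ σ ∈ {σ : ProperFace P | β σ < s} := by
      rw [Set.mem_ofPred_eq, hβ]
      exact max_lt hρ.1 h
    exact (hρ.2 hmem (Set.inter_subset_left : ρ.1 ∩ σ.1 ⊆ ρ.1) : ρ.1 ⊆ ρ.1 ∩ σ.1).trans
      Set.inter_subset_right
  · exact ⟨P, IsExposed.refl P, fun σ => ⟨fun h => absurd h σ.not_subset, fun h => absurd ⟨σ, h⟩ hne⟩⟩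

/-- The smallest face, possibly `P`, that is contained in all `σ` with `β σ < s`. -/
noncomputable def thresholdFace (hP : IsPolytope P) {β : ProperFace P → ℝ} (hβ : IsMaxitive β)
    (s : ℝ) : Set (EuclideanSpace ℝ (Fin n)) :=
  (hβ.exists_threshold hP s).choose

theorem isExposed_thresholdFace (hP : IsPolytope P) {β : ProperFace P → ℝ} (hβ : IsMaxitive β)
    (s : ℝ) : IsExposed ℝ P (thresholdFace hP hβ s) :=
  (hβ.exists_threshold hP s).choose_spec.1

theorem thresholdFace_subset_iff (hP : IsPolytope P) {β : ProperFace P → ℝ} (hβ : IsMaxitive β)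
    {s : ℝ} {σ : ProperFace P} : thresholdFace hP hβ s ⊆ σ.1 ↔ β σ < s :=
  (hβ.exists_threshold hP s).choose_spec.2 σ

theorem thresholdFace_subset (hP : IsPolytope P) {β β' : ProperFace P → ℝ} (hβ : IsMaxitive β)
    (hβ' : IsMaxitive β') {s s' : ℝ} (h : ∀ σ, β' σ < s' → β σ < s) :
    thresholdFace hP hβ s ⊆ thresholdFace hP hβ' s' := by
  by_cases hne : thresholdFace hP hβ' s' = P
  · exact (isExposed_thresholdFace hP hβ s).subset.trans hne.superset
  · exact (thresholdFace_subset_iff hP hβ (σ := ⟨_, isExposed_thresholdFace hP hβ' s', hne⟩)).mpr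
      (h _ ((thresholdFace_subset_iff hP hβ').mp subset_rfl))

/-- The empty face has the largest value of `β`, hence is never strictly below the threshold `β σ`.
-/
theorem isFace_thresholdFace (hP : IsPolytope P) (hne : P.Nonempty) {β : ProperFace P → ℝ}
    (hβ : IsMaxitive β) (σ : ProperFace P) : IsFace P (thresholdFace hP hβ (β σ)) := by
  refine ⟨Set.nonempty_iff_ne_empty.mpr fun h => ?_, isExposed_thresholdFace hP hβ _⟩
  have h1 : thresholdFace hP hβ (β σ) ⊆ (emptyFace hne).1 := h.subset
  rw [thresholdFace_subset_iff] at h1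
  exact absurd (hβ.antitone (σ := emptyFace hne) (τ := σ) (Set.empty_subset _)) h1.not_ge

/-- The flag of the threshold faces of a maxitive function. -/
noncomputable def thresholdFlag (hP : IsPolytope P) (hne : P.Nonempty) {β : ProperFace P → ℝ}
    (hβ : IsMaxitive β) : StarFlag P where
  faces := insert P (Set.range fun σ => thresholdFace hP hβ (β σ))
  isFace := by
    rintro _ (rfl | ⟨σ, rfl⟩)
    · exact ⟨hne, IsExposed.refl _⟩
    · exact isFace_thresholdFace hP hne hβ σ
  isChain := by
    refine IsChain.insert ?_ ?_
    · rintro _ ⟨σ, rfl⟩ _ ⟨τ, rfl⟩ -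
      rcases le_total (β σ) (β τ) with h | h
      · exact Or.inr (thresholdFace_subset hP hβ hβ fun κ hκ => hκ.trans_le h)
      · exact Or.inl (thresholdFace_subset hP hβ hβ fun κ hκ => hκ.trans_le h)
    · rintro _ ⟨σ, rfl⟩ -
      exact Or.inr (isExposed_thresholdFace hP hβ _).subset
  self_mem := Set.mem_insert _ _

/-- Every maxitive function is, up to a constant, the coordinate vector of a point. -/
theorem IsMaxitive.exists_embed_eq (hP : IsPolytope P) (hne : (interior P).Nonempty)
    {β : ProperFace P → ℝ} (hβ : IsMaxitive β) : ∃ u : ChamberUnion P,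
      u.1 = thresholdFlag hP (hne.mono interior_subset) hβ ∧ ∃ c, ∀ σ, embed u σ = β σ + c := by
  have := finite_properFace hP
  have hneP : P.Nonempty := hne.mono interior_subset
  have : Nonempty (ProperFace P) := ⟨emptyFace hneP⟩
  have hconv : Convex ℝ P := by
    obtain ⟨V, hV⟩ := hP
    exact hV ▸ convex_convexHull ℝ _
  set ρ := fun σ => thresholdFace hP hβ (β σ) with hρ
  set F := thresholdFlag hP hneP hβ with hF
  have hρF : ∀ σ, ρ σ ∈ F.faces := fun σ => Set.mem_insert_of_mem _ ⟨σ, rfl⟩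
  have hρle : ∀ σ τ, ρ σ ⊆ τ.1 ↔ β τ < β σ := fun σ τ => thresholdFace_subset_iff hP hβ
  -- The `j`-th coordinate will be the highest level whose threshold face has dimension at least
  -- `j`. Such levels exist because the threshold face at the minimum of `β` is `P`.
  have hex : ∀ j : Fin (n + 1), ∃ κ, (j : ℕ) ≤ faceDim (ρ κ) ∧
      ∀ σ, (j : ℕ) ≤ faceDim (ρ σ) → β σ ≤ β κ := by
    intro j
    have hA : {σ | (j : ℕ) ≤ faceDim (ρ σ)}.Nonempty := by
      obtain ⟨κ, hκ⟩ := Finite.exists_min β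
      have hP' : ρ κ = P := by
        by_contra hcon
        have := (hρle κ ⟨ρ κ, isExposed_thresholdFace hP hβ _, hcon⟩).mp subset_rfl
        exact absurd (hκ _) this.not_ge
      refine ⟨κ, ?_⟩
      rw [Set.mem_ofPred_eq, hP', faceDim_self hconv hne]
      omega
    obtain ⟨κ, hκ, hmax⟩ := Set.exists_max_image _ β (Set.toFinite _) hA
    exact ⟨κ, hκ, hmax⟩
  choose κ hκ hmax using hex
  have hmem : (Submodule.Quotient.mk (fun j => β (κ j)) : ModelFlat n) ∈ chamberFace n F.type := by
    have hanti : ∀ i : Fin n, β (κ i.succ) ≤ β (κ i.castSucc) := fun i =>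
      hmax _ _ (le_trans (by simp) (hκ i.succ))
    refine ⟨fun i => ?_, fun i hi => ?_⟩
    · rw [coordDiff_mk]
      exact sub_nonneg.mpr (hanti i)
    · rw [coordDiff_mk, sub_eq_zero]
      refine le_antisymm (hmax _ _ ?_) (hanti i)
      by_contra hlt
      have h1 := hκ i.castSucc
      simp only [Fin.val_castSucc, Fin.val_succ] at h1 hlt
      refine hi ⟨_, hρF (κ i.castSucc), fun h => hlt ?_, by omega⟩
      rw [h, faceDim_self hconv hne]
      omega
  refine ⟨⟨F, _, hmem⟩, rfl, -β (κ 0), fun σ => ?_⟩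
  rw [embed, coordAt, coordDiff_mk, ← sub_eq_add_neg]
  congr 1
  have hmin : min (minDim F σ) n = minDim F σ := min_eq_left (minDim_le_dim F σ)
  refine le_antisymm ?_ (hmax _ _ ?_)
  · have h1 := hκ ⟨min (minDim F σ) n, by omega⟩
    simp only [hmin] at h1 ⊢
    have h2 := StarFlag.not_subset_of_minDim_le (hρF _) h1
    rw [hρle] at h2
    exact not_lt.mp h2
  · simp only [hmin]
    exact minDim_le (hρF σ) (by rw [hρle]; exact lt_irrefl _)

/-- Two maxitive functions that never order two faces in opposite ways come from the same
chamber. -/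
theorem exists_common_chamber (hP : IsPolytope P) (hne : (interior P).Nonempty)
    {β β' : ProperFace P → ℝ} (hβ : IsMaxitive β) (hβ' : IsMaxitive β')
    (h : ∀ σ τ, β σ < β τ → β' σ ≤ β' τ) : ∃ (F : StarFlag P) (a b : chamberFace n F.type),
      (∃ c, ∀ σ, embed ⟨F, a⟩ σ = β σ + c) ∧ ∃ c, ∀ σ, embed ⟨F, b⟩ σ = β' σ + c := by
  obtain ⟨u, hu, c, hc⟩ := hβ.exists_embed_eq hP hne
  obtain ⟨v, hv, c', hc'⟩ := hβ'.exists_embed_eq hP hne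
  -- Two incomparable threshold faces would give faces `σ`, `τ` ordered oppositely by `β` and `β'`;
  -- so the union of both flags is a flag.
  have key : ∀ s s', thresholdFace hP hβ s ⊆ thresholdFace hP hβ' s' ∨
      thresholdFace hP hβ' s' ⊆ thresholdFace hP hβ s := by
    intro s s'
    by_contra! hcon
    have h1 : ∃ σ, β' σ < s' ∧ s ≤ β σ := by
      by_contra! h1
      exact hcon.1 (thresholdFace_subset hP hβ hβ' h1)
    have h2 : ∃ σ, β σ < s ∧ s' ≤ β' σ := by
      by_contra! h2
      exact hcon.2 (thresholdFace_subset hP hβ' hβ h2)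
    obtain ⟨σ, hσ', hσ⟩ := h1
    obtain ⟨τ, hτ, hτ'⟩ := h2
    have := h τ σ (by linarith)
    linarith
  let F : StarFlag P :=
    { faces := u.1.faces ∪ v.1.faces
      isFace := fun σ hσ => hσ.elim (u.1.isFace σ) (v.1.isFace σ)
      isChain := by
        have hcross : ∀ σ ∈ u.1.faces, ∀ τ ∈ v.1.faces, σ ⊆ τ ∨ τ ⊆ σ := by
          intro σ hσ τ hτ
          have hσP := (u.1.isFace σ hσ).2.subset
          have hτP := (v.1.isFace τ hτ).2.subset
          rw [hu] at hσ
          rw [hv] at hτ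
          rcases hσ with rfl | ⟨σ, rfl⟩
          · exact Or.inr hτP
          rcases hτ with rfl | ⟨τ, rfl⟩
          · exact Or.inl hσP
          exact key _ _
        rintro σ (hσ | hσ) τ (hτ | hτ) hστ
        · exact u.1.isChain hσ hτ hστ
        · exact hcross σ hσ τ hτ
        · exact (hcross τ hτ σ hσ).symm
        · exact v.1.isChain hσ hτ hστ
      self_mem := Or.inl u.1.self_mem }
  obtain ⟨⟨_, a⟩, rfl, hua⟩ := exists_glue (u := u) (F := F) Set.subset_union_left
  obtain ⟨⟨_, b⟩, rfl, hvb⟩ := exists_glue (u := v) (F := F) Set.subset_union_right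
  exact ⟨F, a, b, ⟨c, fun σ => by rw [← embed_eq_of_glue hua, hc]⟩,
    ⟨c', fun σ => by rw [← embed_eq_of_glue hvb, hc']⟩⟩

end Maxitive

/-! ### The metric of the realization -/

section Metric

variable {n : ℕ} {P : Set (EuclideanSpace ℝ (Fin n))}

/-- The coordinates of a point of the realization. -/
noncomputable def ModelSpace.coords (p : ModelSpace P) : ProperFace P → ℝ :=
  Quot.lift embed (fun _ _ => embed_eq_of_glue) p

theorem ModelSpace.coords_mk (u : ChamberUnion P) : (ModelSpace.mk u).coords = embed u := rfl

theorem modelEDist_mk_le (u v : ChamberUnion P) :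
    modelEDist (ModelSpace.mk u) (ModelSpace.mk v) ≤ unionEDist u v := by
  refine iInf_le_of_le 0 (iInf_le_of_le (fun _ => u) (iInf_le_of_le (fun _ => v)
    (iInf_le_of_le rfl (iInf_le_of_le rfl (iInf_le_of_le (fun k => k.elim0) ?_)))))
  simp

theorem modelEDist_mk_le_add (u v : ChamberUnion P) (q : ModelSpace P) :
    modelEDist (ModelSpace.mk u) q ≤ unionEDist u v + modelEDist (ModelSpace.mk v) q := by
  conv_rhs => rw [modelEDist]
  simp only [ENNReal.add_iInf]
  refine le_iInf fun N => le_iInf fun u' => le_iInf fun v' => le_iInf fun h0 => le_iInf fun h1 =>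
    le_iInf fun h2 => ?_
  refine iInf_le_of_le (N + 1) (iInf_le_of_le (Fin.cons u u') (iInf_le_of_le (Fin.cons v v')
    (iInf_le_of_le rfl (iInf_le_of_le ?_ (iInf_le_of_le ?_ ?_)))))
  · rw [← Fin.succ_last, Fin.cons_succ, h1]
  · intro k
    refine Fin.cases ?_ (fun k => ?_) k
    · simp [h0]
    · rw [← Fin.succ_castSucc, Fin.cons_succ, Fin.cons_succ]
      exact h2 k
  · rw [Fin.sum_univ_succ]
    simp

theorem unionEDist_self_piece (hP : IsPolytope P) (hne : (interior P).Nonempty) (F : StarFlag P)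
    (a b : chamberFace n F.type) : unionEDist ⟨F, a⟩ ⟨F, b⟩ =
      ENNReal.ofReal (osc (embed ⟨F, a⟩ - embed ⟨F, b⟩)) := by
  rw [osc_embed_sub hP hne]
  simp [unionEDist]

theorem le_unionEDist (hP : IsPolytope P) (hne : (interior P).Nonempty) (u v : ChamberUnion P) :
    ENNReal.ofReal (osc (embed u - embed v)) ≤ unionEDist u v := by
  by_cases h : u.1 = v.1
  · obtain ⟨F, a⟩ := u
    obtain ⟨F', b⟩ := v
    obtain rfl : F = F' := h
    rw [unionEDist_self_piece hP hne]
  · simp [unionEDist, h]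

theorem le_modelEDist (hP : IsPolytope P) (hne : (interior P).Nonempty) (p q : ModelSpace P) :
    ENNReal.ofReal (osc (p.coords - q.coords)) ≤ modelEDist p q := by
  have := finite_properFace hP
  have : Nonempty (ProperFace P) := ⟨emptyFace (hne.mono interior_subset)⟩
  refine le_iInf fun N => le_iInf fun u => le_iInf fun v => le_iInf fun h0 => le_iInf fun h1 =>
    le_iInf fun h2 => ?_
  induction N generalizing q with
  | zero =>
    rw [← h0, ← h1, Fin.sum_univ_one]
    exact le_unionEDist hP hne (u 0) (v 0)
  | succ N ih =>
    have h3 := ih (ModelSpace.mk (v (Fin.last N).castSucc)) (fun k => u k.castSucc)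
      (fun k => v k.castSucc) h0 rfl (fun k => h2 k.castSucc)
    rw [Fin.sum_univ_castSucc, ← h1]
    refine le_trans ?_ (add_le_add h3 (le_unionEDist hP hne _ _))
    rw [← ENNReal.ofReal_add (osc_nonneg _) (osc_nonneg _)]
    refine ENNReal.ofReal_le_ofReal ?_
    rw [h2 (Fin.last N)]
    exact osc_sub_le _ _ _

theorem embed_eq_of_eq_add_const (hne : P.Nonempty) {u v : ChamberUnion P}
    {β : ProperFace P → ℝ} (hu : ∃ c, ∀ σ, embed u σ = β σ + c)
    (hv : ∃ c, ∀ σ, embed v σ = β σ + c) : embed u = embed v := by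
  obtain ⟨c, hc⟩ := hu
  obtain ⟨c', hc'⟩ := hv
  have h1 := hc (emptyFace hne)
  have h2 := hc' (emptyFace hne)
  rw [embed_emptyFace] at h1 h2
  funext σ
  rw [hc, hc']
  linarith

/-- The tropical segment from `β` to `β'` (up to constants). -/
noncomputable def tropSegment (β β' : ProperFace P → ℝ) (t : ℝ) (σ : ProperFace P) : ℝ :=
  max (β σ) (β' σ + t)

/-- The order of two values can reverse only when one is still `β τ` and the other already `β' σ +
t`, that is, when the parameter crosses the breakpoint `β τ - β' σ`. -/
theorem tropSegment_comonotone {β β' : ProperFace P → ℝ} {s t : ℝ} (hst : s ≤ t)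
    (h : ∀ σ τ, ¬ (s < β σ - β' τ ∧ β σ - β' τ < t)) (σ τ : ProperFace P)
    (hlt : tropSegment β β' s σ < tropSegment β β' s τ) :
    tropSegment β β' t σ ≤ tropSegment β β' t τ := by
  unfold tropSegment at *
  by_contra! hgt
  rcases max_choice (β τ) (β' τ + s) with h1 | h1 <;>
    rcases max_choice (β σ) (β' σ + t) with h2 | h2 <;> rw [h1, max_lt_iff] at hlt <;>
    rw [h2, max_lt_iff] at hgt <;>
    first
      | linarith
      | exact h τ σ ⟨by linarith, by linarith⟩

/-- Each coordinate rises by an amount between `0` and `t - s`. -/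
theorem osc_tropSegment_le [Nonempty (ProperFace P)] {β β' : ProperFace P → ℝ} {s t : ℝ}
    (hst : s ≤ t) : osc (tropSegment β β' s - tropSegment β β' t) ≤ t - s := by
  have h1 : ∀ σ, tropSegment β β' s σ ≤ tropSegment β β' t σ := fun σ =>
    max_le_max le_rfl (by linarith)
  have h2 : ∀ σ, tropSegment β β' t σ ≤ tropSegment β β' s σ + (t - s) := fun σ => by
    have h3 := le_max_left (β σ) (β' σ + s)
    have h4 := le_max_right (β σ) (β' σ + s)
    unfold tropSegment
    exact max_le (by linarith) (by linarith)
  refine osc_le fun σ τ => ?_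
  have := h1 σ
  have := h2 τ
  simp only [Pi.sub_apply]
  linarith

theorem IsMaxitive.tropSegment {β β' : ProperFace P → ℝ} (hβ : IsMaxitive β) (hβ' : IsMaxitive β')
    (t : ℝ) : IsMaxitive (tropSegment β β' t) :=
  hβ.max (hβ'.add_const t)

theorem osc_le_of_eq_add_const [Finite (ProperFace P)] [Nonempty (ProperFace P)]
    {f g β β' : ProperFace P → ℝ} (hf : ∃ c, ∀ σ, f σ = β σ + c) (hg : ∃ c, ∀ σ, g σ = β' σ + c) :
    osc (f - g) ≤ osc (β - β') := by
  obtain ⟨c, hc⟩ := hf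
  obtain ⟨c', hc'⟩ := hg
  refine osc_le fun σ τ => ?_
  have := le_osc (β - β') σ τ
  simp only [Pi.sub_apply, hc, hc'] at *
  linarith

/-- Between consecutive breakpoints the segment has both ends in a common chamber and costs at most
the parameter increment. Cutting at the first breakpoint and inducting on their number, the
increments add up to `t - s`. -/
theorem modelEDist_le_of_tropSegment (hP : IsPolytope P) (hne : (interior P).Nonempty)
    {β β' : ProperFace P → ℝ} (hβ : IsMaxitive β) (hβ' : IsMaxitive β') {B : Finset ℝ}
    (hB : ∀ σ τ, β σ - β' τ ∈ B) {s t : ℝ} (hst : s ≤ t) {u v : ChamberUnion P}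
    (hu : ∃ c, ∀ σ, embed u σ = tropSegment β β' s σ + c)
    (hv : ∃ c, ∀ σ, embed v σ = tropSegment β β' t σ + c) :
    modelEDist (ModelSpace.mk u) (ModelSpace.mk v) ≤ ENNReal.ofReal (t - s) := by
  have := finite_properFace hP
  have hneP : P.Nonempty := hne.mono interior_subset
  have : Nonempty (ProperFace P) := ⟨emptyFace hneP⟩
  have hstep : ∀ {s t : ℝ}, s ≤ t → (∀ b ∈ B, ¬ (s < b ∧ b < t)) →
      ∃ (F : StarFlag P) (a b : chamberFace n F.type),
        (∃ c, ∀ σ, embed ⟨F, a⟩ σ = tropSegment β β' s σ + c) ∧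
        (∃ c, ∀ σ, embed ⟨F, b⟩ σ = tropSegment β β' t σ + c) ∧
        unionEDist ⟨F, a⟩ ⟨F, b⟩ ≤ ENNReal.ofReal (t - s) := by
    intro s t hst hno
    obtain ⟨F, a, b, ha, hb⟩ := exists_common_chamber hP hne (hβ.tropSegment hβ' s)
      (hβ.tropSegment hβ' t) (tropSegment_comonotone hst fun σ τ => hno _ (hB σ τ))
    refine ⟨F, a, b, ha, hb, ?_⟩
    rw [unionEDist_self_piece hP hne]
    exact ENNReal.ofReal_le_ofReal ((osc_le_of_eq_add_const ha hb).trans (osc_tropSegment_le hst))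
  induction hN : (B.filter fun b => s < b ∧ b < t).card using Nat.strong_induction_on
    generalizing s u with
  | _ N ih =>
  subst hN
  rcases (B.filter fun b => s < b ∧ b < t).eq_empty_or_nonempty with hemp | hnonempty
  · obtain ⟨F, a, b, ha, hb, hle⟩ := hstep hst fun b hb hbst =>
      Finset.notMem_empty b (hemp ▸ Finset.mem_filter.mpr ⟨hb, hbst⟩)
    rw [mk_eq_of_embed_eq hP hne (embed_eq_of_eq_add_const hneP hu ha),
      mk_eq_of_embed_eq hP hne (embed_eq_of_eq_add_const hneP hv hb)]
    exact (modelEDist_mk_le _ _).trans hle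
  · set r := (B.filter fun b => s < b ∧ b < t).min' hnonempty with hr
    obtain ⟨hrB, hsr, hrt⟩ := Finset.mem_filter.mp (Finset.min'_mem _ hnonempty)
    rw [← hr] at hrB hsr hrt
    obtain ⟨F, a, b, ha, hb, hle⟩ := hstep hsr.le fun b hb hbst =>
      absurd (Finset.min'_le _ b (Finset.mem_filter.mpr ⟨hb, hbst.1, hbst.2.trans hrt⟩))
        hbst.2.not_ge
    have hlt : (B.filter fun b => r < b ∧ b < t).card < (B.filter fun b => s < b ∧ b < t).card := by
      refine Finset.card_lt_card (Finset.ssubset_iff_subset_ne.mpr ⟨fun b hb => ?_, fun h => ?_⟩)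
      · obtain ⟨h1, h2, h3⟩ := Finset.mem_filter.mp hb
        exact Finset.mem_filter.mpr ⟨h1, hsr.trans h2, h3⟩
      · have : r ∈ B.filter fun b => r < b ∧ b < t :=
          h ▸ Finset.mem_filter.mpr ⟨hrB, hsr, hrt⟩
        exact lt_irrefl _ (Finset.mem_filter.mp this).2.1
    rw [mk_eq_of_embed_eq hP hne (embed_eq_of_eq_add_const hneP hu ha)]
    refine (modelEDist_mk_le_add _ ⟨F, b⟩ _).trans
      ((add_le_add hle (ih _ hlt hrt.le hb rfl)).trans ?_)
    rw [← ENNReal.ofReal_add (by linarith) (by linarith)]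
    exact ENNReal.ofReal_le_ofReal (by linarith)

/-- The coordinates are an isometric embedding of the realization. -/
theorem modelDist_eq_osc (hP : IsPolytope P) (hne : (interior P).Nonempty) (p q : ModelSpace P) :
    modelDist p q = osc (p.coords - q.coords) := by
  have := finite_properFace hP
  have : Nonempty (ProperFace P) := ⟨emptyFace (hne.mono interior_subset)⟩
  have key : modelEDist p q = ENNReal.ofReal (osc (p.coords - q.coords)) := by
    refine le_antisymm ?_ (le_modelEDist hP hne p q)
    induction p using Quot.ind with | _ u => ?_
    induction q using Quot.ind with | _ v => ?_
    change modelEDist (ModelSpace.mk u) (ModelSpace.mk v) ≤ ENNReal.ofReal (osc (embed u - embed v))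
    -- From the minimum to the maximum of the difference, the tropical segment runs from `embed u`
    -- to a translate of `embed v`; the parameter length is the oscillation.
    obtain ⟨σ, hσ⟩ := Finite.exists_min fun σ => embed u σ - embed v σ
    obtain ⟨τ, hτ⟩ := Finite.exists_max fun σ => embed u σ - embed v σ
    refine (modelEDist_le_of_tropSegment hP hne (isMaxitive_embed u) (isMaxitive_embed v)
      (B := (Set.finite_range fun p : ProperFace P × ProperFace P =>
        embed u p.1 - embed v p.2).toFinset) (fun σ τ => by
        rw [Set.Finite.mem_toFinset]
        exact ⟨(σ, τ), rfl⟩) (hσ τ) ⟨0, fun κ => ?_⟩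
      ⟨-(embed u τ - embed v τ), fun κ => ?_⟩).trans (ENNReal.ofReal_le_ofReal (le_osc (embed u - embed v) τ σ))
    · rw [tropSegment, max_eq_left (by linarith [hσ κ]), add_zero]
    · rw [tropSegment, max_eq_right (by linarith [hτ κ])]
      ring
  rw [modelDist, key, ENNReal.toReal_ofReal (osc_nonneg _)]

end Metric

/-! ### Comparison of logarithmic and tropical coordinates -/

section Comparison

variable {n : ℕ} {P : Set (EuclideanSpace ℝ (Fin n))} {V : Finset (EuclideanSpace ℝ (Fin n))}

/-- The maximum of the weights of the vertices outside a face. -/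
noncomputable def tropForms (V : Finset (EuclideanSpace ℝ (Fin n)))
    (w : EuclideanSpace ℝ (Fin n) → ℝ) (σ : ProperFace P) : ℝ :=
  sSup (w '' {v | v ∈ V ∧ v ∉ σ.1})

theorem isGreatest_tropForms (hV : P = convexHull ℝ (V : Set (EuclideanSpace ℝ (Fin n))))
    (w : EuclideanSpace ℝ (Fin n) → ℝ) (σ : ProperFace P) :
    IsGreatest (w '' {v | v ∈ V ∧ v ∉ σ.1}) (tropForms V w σ) := by
  obtain ⟨v, hv, hvσ⟩ := σ.exists_vertex hV
  have hfin : (w '' {v | v ∈ V ∧ v ∉ σ.1}).Finite :=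
    (V.finite_toSet.subset fun v hv => hv.1).image w
  have hne : (w '' {v | v ∈ V ∧ v ∉ σ.1}).Nonempty := ⟨w v, v, ⟨hv, hvσ⟩, rfl⟩
  exact ⟨hne.csSup_mem hfin, fun _ h => le_csSup hfin.bddAbove h⟩

theorem isMaxitive_tropForms (hV : P = convexHull ℝ (V : Set (EuclideanSpace ℝ (Fin n))))
    (w : EuclideanSpace ℝ (Fin n) → ℝ) : IsMaxitive (P := P) (tropForms V w) := by
  intro σ τ
  have h := (isGreatest_tropForms hV w σ).union (isGreatest_tropForms hV w τ)
  rw [← Set.image_union] at h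
  refine (isGreatest_tropForms hV w (interFace σ τ)).unique ?_
  convert h using 2
  ext v
  simp only [interFace, Set.mem_ofPred_eq, Set.mem_union, Set.mem_inter_iff]
  tauto

/-- The weight of `v` is the coordinate at the dimension of the smallest flag face containing `v`.
Off `σ` the maximum is attained at a generator in the smallest flag face not inside `σ`. -/
theorem exists_tropForms_eq_embed (hV : P = convexHull ℝ (V : Set (EuclideanSpace ℝ (Fin n))))
    (u : ChamberUnion P) : ∃ w : EuclideanSpace ℝ (Fin n) → ℝ, embed u = tropForms V w := by
  set k : EuclideanSpace ℝ (Fin n) → ℕ := fun v =>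
    sInf {k | ∃ τ ∈ u.1.faces, v ∈ τ ∧ faceDim τ = k} with hk
  refine ⟨fun v => coordAt (k v) (u.2 : ModelFlat n), funext fun σ => ?_⟩
  have hanti := coordAt_antitone u.2.2
  refine IsGreatest.unique ?_ (isGreatest_tropForms hV _ σ)
  have hle : ∀ v ∈ V, v ∉ σ.1 → minDim u.1 σ ≤ k v := by
    intro v hv hvσ
    obtain ⟨τ, hτ, hvτ, hdim⟩ := Nat.sInf_mem
      (s := {k | ∃ τ ∈ u.1.faces, v ∈ τ ∧ faceDim τ = k}) ⟨_, P, u.1.self_mem, vertex_mem hV hv, rfl⟩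
    exact (minDim_le hτ fun hsub => hvσ (hsub hvτ)).trans hdim.le
  constructor
  · obtain ⟨τ, hτ, hnot, hdim⟩ := minDim_spec u.1 σ
    obtain ⟨v, hv, hvτ, hvσ⟩ := exists_vertex_notMem hV σ.2.1 (u.1.isFace τ hτ).2 hnot
    have : k v = minDim u.1 σ :=
      le_antisymm (Nat.sInf_le ⟨τ, hτ, hvτ, hdim⟩) (hle v hv hvσ)
    exact ⟨v, ⟨hv, hvσ⟩, by simp only [this, embed]⟩
  · rintro _ ⟨v, ⟨hv, hvσ⟩, rfl⟩
    exact hanti (hle v hv hvσ)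

/-- The logarithms of the forms at a point of the polytope with exponential weights agree, up to a
uniform constant, with the maxima of the exponents. -/
theorem exists_logForms_bound (hP : IsPolytope P)
    (hV : P = convexHull ℝ (V : Set (EuclideanSpace ℝ (Fin n)))) :
    ∃ C, ∀ (w : EuclideanSpace ℝ (Fin n) → ℝ) (l e : ℝ), 0 ≤ l →
      ∑ v ∈ V, Real.exp (l * w v + e) = 1 → ∀ σ : ProperFace P,
        |logForms P (∑ v ∈ V, Real.exp (l * w v + e) • v) σ - (l * tropForms V w σ + e)| ≤ C := by
  classical
  have := finite_properFace hP
  have key : ∀ σ : ProperFace P, ∃ C, ∀ (w : EuclideanSpace ℝ (Fin n) → ℝ) (l e : ℝ), 0 ≤ l →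
      ∑ v ∈ V, Real.exp (l * w v + e) = 1 →
        |logForms P (∑ v ∈ V, Real.exp (l * w v + e) • v) σ - (l * tropForms V w σ + e)| ≤ C := by
    intro σ
    have hnn : ∀ v ∈ V, 0 ≤ faceForm σ v := fun v hv => faceForm_nonneg σ (vertex_mem hV hv)
    obtain ⟨v₁, hv₁, hv₁σ⟩ := σ.exists_vertex hV
    obtain ⟨v₀, hv₀, hmin⟩ := Finset.exists_min_image (V.filter fun v => v ∉ σ.1)
      (fun v => faceForm σ v) ⟨v₁, Finset.mem_filter.mpr ⟨hv₁, hv₁σ⟩⟩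
    obtain ⟨hv₀V, hv₀σ⟩ := Finset.mem_filter.mp hv₀
    have hm : 0 < faceForm σ v₀ := faceForm_pos σ (vertex_mem hV hv₀V) hv₀σ
    have hM : 0 < ∑ v ∈ V, faceForm σ v := Finset.sum_pos' hnn ⟨v₀, hv₀V, hm⟩
    -- A single dominant term bounds the form below, using its least nonzero value on `V`; replacing
    -- all exponents by the largest bounds it above.
    refine ⟨max (-Real.log (faceForm σ v₀)) (Real.log (∑ v ∈ V, faceForm σ v)),
      fun w l e hl h1 => ?_⟩
    obtain ⟨⟨v, ⟨hv, hvσ⟩, hvw⟩, hub⟩ := isGreatest_tropForms hV w σ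
    have hlow : Real.exp (l * tropForms V w σ + e) * faceForm σ v₀ ≤
        faceForm σ (∑ v ∈ V, Real.exp (l * w v + e) • v) := by
      rw [AffineMap.map_sum_smul _ h1, ← hvw]
      refine le_trans ?_ (Finset.single_le_sum
        (f := fun v => Real.exp (l * w v + e) * faceForm σ v)
        (fun v hv => mul_nonneg (Real.exp_pos _).le (hnn v hv)) hv)
      exact mul_le_mul_of_nonneg_left (hmin v (Finset.mem_filter.mpr ⟨hv, hvσ⟩)) (Real.exp_pos _).le
    have hupp : faceForm σ (∑ v ∈ V, Real.exp (l * w v + e) • v) ≤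
        Real.exp (l * tropForms V w σ + e) * ∑ v ∈ V, faceForm σ v := by
      rw [AffineMap.map_sum_smul _ h1, Finset.mul_sum]
      refine Finset.sum_le_sum fun v hv => ?_
      by_cases hvσ : v ∈ σ.1
      · rw [(faceForm_eq_zero σ (vertex_mem hV hv)).mpr hvσ]; simp
      · refine mul_le_mul_of_nonneg_right (Real.exp_le_exp.mpr ?_) (hnn v hv)
        have := mul_le_mul_of_nonneg_left (hub ⟨v, ⟨hv, hvσ⟩, rfl⟩) hl
        linarith
    have hpos := (mul_pos (Real.exp_pos (l * tropForms V w σ + e)) hm).trans_le hlow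
    have hlow' := Real.log_le_log (mul_pos (Real.exp_pos _) hm) hlow
    have hupp' := Real.log_le_log hpos hupp
    rw [Real.log_mul (Real.exp_pos _).ne' hm.ne', Real.log_exp] at hlow'
    rw [Real.log_mul (Real.exp_pos _).ne' hM.ne', Real.log_exp] at hupp'
    rw [logForms, abs_le]
    constructor
    · have := le_max_left (-Real.log (faceForm σ v₀)) (Real.log (∑ v ∈ V, faceForm σ v))
      linarith
    · have := le_max_right (-Real.log (faceForm σ v₀)) (Real.log (∑ v ∈ V, faceForm σ v))
      linarith
  choose C hC using key
  obtain ⟨C', hC'⟩ := (Set.finite_range C).bddAbove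
  exact ⟨C', fun w l e hl h1 σ => (hC σ w l e hl h1).trans (hC' ⟨σ, rfl⟩)⟩

theorem osc_const_mul {ι : Type*} {a : ℝ} (ha : 0 ≤ a) (g : ι → ℝ) :
    osc (fun i => a * g i) = a * osc g := by
  simp only [osc, Real.mul_iSup_of_nonneg ha, mul_sub]

/-- Every interior point is close in logarithmic coordinates to a point of the realization. -/
theorem exists_model_near (hP : IsPolytope P) (hne : (interior P).Nonempty) :
    ∃ C, ∀ l : ℝ, 0 < l → ∀ y ∈ interior P, ∃ (p : ModelSpace P) (c : ℝ), ∀ σ,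
      |1 / l * logForms P y σ - p.coords σ - c| ≤ C / l := by
  obtain ⟨V, hV⟩ := id hP
  obtain ⟨C, hC⟩ := exists_logForms_bound hP hV
  refine ⟨C, fun l hl y hy => ?_⟩
  obtain ⟨c, hc, hc1, hcy⟩ := exists_pos_weights hV hy
  set w := fun v => Real.log (c v) / l with hw
  have hexp : ∀ v ∈ V, Real.exp (l * w v + 0) = c v := fun v hv => by
    rw [hw, add_zero, mul_div_cancel₀ _ hl.ne', Real.exp_log (hc v hv)]
  obtain ⟨u, -, b, hb⟩ := (isMaxitive_tropForms hV w).exists_embed_eq hP hne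
  refine ⟨ModelSpace.mk u, -b, fun σ => ?_⟩
  have h := hC w l 0 hl.le (by rw [Finset.sum_congr rfl hexp, hc1]) σ
  rw [Finset.sum_congr rfl fun v hv => by rw [hexp v hv], hcy] at h
  rw [ModelSpace.coords_mk, hb, le_div_iff₀ hl, ← abs_of_pos hl, ← abs_mul, abs_of_pos hl]
  refine (congrArg abs ?_).trans_le h
  field_simp
  ring

/-- Every point of the realization is close in logarithmic coordinates to an interior point. -/
theorem exists_interior_near (hP : IsPolytope P) (hne : (interior P).Nonempty) :
    ∃ C, ∀ l : ℝ, 0 < l → ∀ p : ModelSpace P, ∃ y ∈ interior P, ∃ c : ℝ, ∀ σ,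
      |1 / l * logForms P y σ - p.coords σ - c| ≤ C / l := by
  obtain ⟨V, hV⟩ := id hP
  obtain ⟨C, hC⟩ := exists_logForms_bound hP hV
  refine ⟨C, fun l hl p => ?_⟩
  induction p using Quot.ind with | _ u => ?_
  obtain ⟨w, hw⟩ := exists_tropForms_eq_embed hV u
  have hVne : V.Nonempty := by
    obtain ⟨x, hx⟩ := hne
    rw [Finset.nonempty_iff_ne_empty]
    rintro rfl
    simpa [hV] using interior_subset hx
  -- Dividing by `Z` makes the weights sum to one; its logarithm is an additive constant, harmless
  -- modulo constants.
  set Z := ∑ v ∈ V, Real.exp (l * w v) with hZ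
  have hZpos : 0 < Z := Finset.sum_pos (fun v _ => Real.exp_pos _) hVne
  have h1 : ∑ v ∈ V, Real.exp (l * w v + -Real.log Z) = 1 := by
    simp_rw [Real.exp_add, Real.exp_neg, Real.exp_log hZpos]
    rw [← Finset.sum_mul, ← hZ, mul_inv_cancel₀ hZpos.ne']
  refine ⟨_, mem_interior_of_pos_weights hV hne (fun v _ => Real.exp_pos _) h1,
    -Real.log Z / l, fun σ => ?_⟩
  have h := hC w l _ hl.le h1 σ
  change |_ - embed u σ - _| ≤ _
  rw [hw, le_div_iff₀ hl, ← abs_of_pos hl, ← abs_mul, abs_of_pos hl]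
  refine (congrArg abs ?_).trans_le h
  field_simp
  ring

theorem coords_conePoint (hne : P.Nonempty) (σ : ProperFace P) :
    (conePoint P hne).coords σ = 0 :=
  map_zero (coordAt _)

end Comparison

/-! ### Assembling the approximations. -/

theorem mainTheorem4 (n : ℕ) (P : Set (EuclideanSpace ℝ (Fin n))) (hP : IsPolytope P)
    (x : interior P) (lam : ℕ → ℝ) (hlam1 : ∀ k, 1 ≤ lam k) (hlam : Tendsto lam atTop atTop) :
    PointedGHConverges
      (fun k (a b : interior P) => 1 / lam k * hilbertDist (interior P) (a : EuclideanSpace ℝ (Fin n)) b)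
      (fun _ => x)
      (modelDist (P := P))
      (conePoint P ⟨x, interior_subset x.2⟩) := by
  classical
  have hne : (interior P).Nonempty := ⟨x, x.2⟩
  have hneP : P.Nonempty := ⟨x, interior_subset x.2⟩
  have := finite_properFace hP
  have : Nonempty (ProperFace P) := ⟨emptyFace hneP⟩
  obtain ⟨C₁, hC₁⟩ := exists_model_near hP hne
  obtain ⟨C₂, hC₂⟩ := exists_interior_near hP hne
  obtain ⟨C₃, hC₃⟩ := (Set.finite_range fun σ => |logForms P x σ|).bddAbove
  set C := max C₁ (max C₂ C₃) with hC
  intro r _ ε hε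
  -- Each point is moved by at most `2 * (C / lam k)`, so two endpoints cost `4 * (C / lam k) ≤ ε /
  -- 2`.
  filter_upwards [hlam.eventually_ge_atTop (8 * C / ε)] with k hk
  have hl : 0 < lam k := lt_of_lt_of_le one_pos (hlam1 k)
  have hCl : 4 * (C / lam k) ≤ ε / 2 := by
    rw [div_le_iff₀ hε] at hk
    rw [← mul_div_assoc, div_le_iff₀ hl]
    linarith
  set L : interior P → ProperFace P → ℝ := fun y σ => 1 / lam k * logForms P y σ with hL
  have hdist : ∀ a b : interior P,
      1 / lam k * hilbertDist (interior P) (a : EuclideanSpace ℝ (Fin n)) b = osc (L a - L b) := by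
    intro a b
    rw [hilbertDist_eq_osc hP a.2 b.2, ← osc_const_mul (by positivity)]
    congr 1
    funext σ
    simp only [hL, Pi.sub_apply, mul_sub]
  -- The base point must go exactly to the cone point, whose coordinates vanish; the error there is
  -- bounded by the fixed logarithms at `x`, through `C₃`.
  have hnear : ∀ y : interior P, ∃ p : ModelSpace P, (y = x → p = conePoint P hneP) ∧
      osc (L y - p.coords) ≤ 2 * (C / lam k) := by
    intro y
    by_cases hyx : y = x
    · refine ⟨conePoint P hneP, fun _ => rfl, osc_le_of_abs_sub_le (c := 0) fun σ => ?_⟩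
      rw [coords_conePoint, sub_zero, sub_zero, hL, hyx, abs_mul, abs_of_pos (by positivity),
        one_div_mul_eq_div]
      gcongr
      exact (hC₃ ⟨σ, rfl⟩).trans ((le_max_right _ _).trans (le_max_right _ _))
    · obtain ⟨p, c, hp⟩ := hC₁ (lam k) hl y y.2
      refine ⟨p, fun h => absurd h hyx, osc_le_of_abs_sub_le fun σ => (hp σ).trans ?_⟩
      gcongr
      exact le_max_left _ _
  choose f hfx hf using hnear
  refine ⟨f, hfx x rfl, ⟨ε / 2, by linarith, fun a b _ _ => ?_⟩, fun z hz => ?_⟩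
  · rw [hdist, modelDist_eq_osc hP hne]
    have h1 := osc_sub_le (f a).coords (L a) (f b).coords
    have h2 := osc_sub_le (L a) (L b) (f b).coords
    have h3 := osc_sub_le (L a) (f a).coords (L b)
    have h4 := osc_sub_le (f a).coords (f b).coords (L b)
    rw [osc_sub_comm (f a).coords (L a)] at h1
    rw [osc_sub_comm (f b).coords (L b)] at h4
    have := hf a
    have := hf b
    rw [abs_le]
    constructor <;> linarith
  -- The slack `ε` in the radius absorbs the errors at `x` and `y`, so `y` lies in the ball of
  -- radius `r`.
  · obtain ⟨y, hy, c, hyc⟩ := hC₂ (lam k) hl z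
    have hyz : osc (L ⟨y, hy⟩ - z.coords) ≤ 2 * (C / lam k) :=
      osc_le_of_abs_sub_le fun σ => (hyc σ).trans (by
        gcongr
        exact (le_max_left _ _).trans (le_max_right _ _))
    refine ⟨⟨y, hy⟩, ?_, ?_⟩
    · rw [hdist]
      rw [modelDist_eq_osc hP hne] at hz
      have h1 := osc_sub_le (L x) (conePoint P hneP).coords (L ⟨y, hy⟩)
      have h2 := osc_sub_le (conePoint P hneP).coords z.coords (L ⟨y, hy⟩)
      have h3 := hf x
      rw [hfx x rfl] at h3
      rw [osc_sub_comm z.coords] at h2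
      linarith
    · rw [modelDist_eq_osc hP hne]
      have h1 := osc_sub_le z.coords (L ⟨y, hy⟩) (f ⟨y, hy⟩).coords
      have h2 := hf ⟨y, hy⟩
      rw [osc_sub_comm z.coords (L ⟨y, hy⟩)] at h1
      linarith
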